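/- Graphs are finite and may have loops and multiple edges. Let $G$ be a graph with vertex set $V$, $|V|=n$, and enumerated edges $e_1,\dots,e_m$. For a finite set $B$ with $b$ elements let $\mathcal L_B=\bigwedge^*\mathcal S^{(b-1,1)}$, graded by exterior degree, where $\mathcal S^{(b-1,1)}$ is the $\mathfrak S_B$-module of vectors in $\mathbb C^B$ with coordinate sum $0$. For $F\subseteq E(G)$ such that the spanning subgraph $(V,F)$ has connected components with vertex sets $B_1,\dots,B_r$, let $$\mathcal M_F=\operatorname{Ind}_{\mathfrak S_{B_1}\times\cdots\times\mathfrak S_{B_r}}^{\mathfrak S_V}\bigl(\mathcal L_{B_1}\otimes\cdots\otimes\mathcal L_{B_r}\bigr),\qquad \mathcal L_{B_1}\otimes\cdots\otimes\mathcal L_{B_r}=\textstyle\bigwedge^*\bigl(\bigoplus_k\mathcal S^{(b_k-1,1)}\bigr),\ b_k=|B_k|,$$ a graded $\mathfrak S_V$-module, and let $C_{i,j}(G)=\bigoplus_{|F|=i}(\mathcal M_F)_j$. For $e\in F$ and $F'=F\setminus\{e\}$, the per-edge map $\mathcal M_F\to\mathcal M_{F'}$ is the identity if $F$ and $F'$ have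 the same connected components. If a component $B$ of $F$ splits into components $A,A'$ of $F'$ with $a,a'$ vertices, it is the $\mathfrak S_V$-linear map that corresponds, by Frobenius reciprocity and transitivity of induction, to the tensor product of the identity on the other components with the map $\bigwedge^*\operatorname{Res}\mathcal S^{(b-1,1)}\to\bigwedge^*\mathcal T$ induced by the equivariant projection of $\operatorname{Res}^{\mathfrak S_B}_{\mathfrak S_A\times\mathfrak S_{A'}}\mathcal S^{(b-1,1)}=\mathcal T\oplus\mathbf 1$ onto $\mathcal T=\mathcal S^{(a-1,1)}\oplus\mathcal S^{(a'-1,1)}$ (identity on $\mathcal T$, zero on $\mathbf 1$). The differential $d_{i,j}:C_{i,j}(G)\to C_{i-1,j}(G)$ is the sum of these maps, that for removing $e=e_s$ from $F$ being taken with the sign $(-1)^k$, where $k=\#\{s'>s: e_{s'}\notin F\}$. Let $H_{i,j}(G)=\ker d_{i,j}/\operatorname{im}d_{i+1,j}$. The bigraded Frobenius series of $G$ is $$\mathrm{Frob}_G(q,t)=\sum_{i,j\ge 0}(-1)^{i+j}\,t^i q^j\,\mathrm{ch}\bigl(H_{i,j}(G)\bigr),$$ where $\mathrm{ch}$ is the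 Frobenius characteristic, with values in the ring $\Lambda_{\mathbb C}$ of symmetric functions: $\mathrm{ch}(M)=\frac1{n!}\sum_{\sigma\in\mathfrak S_V}\chi_M(\sigma)\,p_{\mathrm{type}(\sigma)}$, so that $\mathrm{ch}(\mathcal S^\lambda)=s_\lambda$. **Corollary.** For all finite graphs $A$ and $B$ with disjoint union $A+B$, $$\mathrm{Frob}_{A+B}(q,t)=\mathrm{Frob}_A(q,t)\cdot\mathrm{Frob}_B(q,t),$$ whatever enumerations of the edges of $A$, of $B$ and of $A+B$ are used to define the three series. -/

import Mathlib

open scoped Graph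

noncomputable section

namespace ChromaticHomology

/-! ### Symmetric functions -/

/-- The ring `Λ_ℂ` of symmetric functions in the indeterminates `x_0, x_1, …`: the formal power
series of bounded degree that are invariant under all permutations of the indeterminates. -/
def SymFun : Subalgebra ℂ (MvPowerSeries ℕ ℂ) where
  carrier := {f | (∀ π : Equiv.Perm ℕ, MvPowerSeries.renameEquiv ℂ π f = f) ∧
    ∃ N : ℕ, ∀ d : ℕ →₀ ℕ, MvPowerSeries.coeff d f ≠ 0 → d.degree ≤ N}
  mul_mem' := by
    classical
    rintro f g ⟨hf, N, hN⟩ ⟨hg, M, hM⟩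
    refine ⟨fun π => by rw [map_mul, hf, hg], N + M, fun d hd => ?_⟩
    rw [MvPowerSeries.coeff_mul] at hd
    obtain ⟨p, hp, hne⟩ := Finset.exists_ne_zero_of_sum_ne_zero hd
    rw [← Finset.HasAntidiagonal.mem_antidiagonal.mp hp, map_add]
    exact add_le_add (hN _ (left_ne_zero_of_mul hne)) (hM _ (right_ne_zero_of_mul hne))
  add_mem' := by
    rintro f g ⟨hf, N, hN⟩ ⟨hg, M, hM⟩
    refine ⟨fun π => by rw [map_add, hf, hg], max N M, fun d hd => ?_⟩
    rw [map_add] at hd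
    by_cases h : MvPowerSeries.coeff d f = 0
    · refine (hM d fun h' => hd ?_).trans (le_max_right _ _)
      rw [h, h', add_zero]
    · exact (hN d h).trans (le_max_left _ _)
  algebraMap_mem' r := by
    classical
    refine ⟨fun π => AlgEquiv.commutes _ r, 0, fun d hd => ?_⟩
    rw [MvPowerSeries.algebraMap_apply, MvPowerSeries.coeff_C] at hd
    by_cases h : d = 0
    · simp [h]
    · simp [h] at hd

open Classical in
/-- The power series `x_0 ^ k + x_1 ^ k + ⋯` (used for `k ≥ 1` only). -/
def powerSumSeries (k : ℕ) : MvPowerSeries ℕ ℂ :=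
  fun d => if ∃ i, d = Finsupp.single i k then 1 else 0

theorem coeff_powerSumSeries (k : ℕ) (d : ℕ →₀ ℕ) [Decidable (∃ i, d = Finsupp.single i k)] :
    MvPowerSeries.coeff d (powerSumSeries k) = if ∃ i, d = Finsupp.single i k then 1 else 0 := by
  have : MvPowerSeries.coeff d (powerSumSeries k) = powerSumSeries k d := rfl
  rw [this, powerSumSeries]
  congr

/-- The power sum symmetric function `p_k`, for `k ≥ 1`. -/
def powerSum (k : ℕ) : SymFun :=
  ⟨powerSumSeries k, by
    classical
    refine ⟨fun π => ?_, k, fun d hd => ?_⟩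
    · ext d
      have hd : d = Finsupp.embDomain π.toEmbedding (Finsupp.equivMapDomain π.symm d) := by
        ext n
        have h := Finsupp.embDomain_apply_self π.toEmbedding
          (Finsupp.equivMapDomain π.symm d) (π.symm n)
        simp only [Equiv.coe_toEmbedding, Equiv.apply_symm_apply] at h
        rw [h, Finsupp.equivMapDomain_apply]
        simp
      have key : MvPowerSeries.coeff d (MvPowerSeries.renameEquiv ℂ π (powerSumSeries k)) =
          MvPowerSeries.coeff (Finsupp.equivMapDomain π.symm d) (powerSumSeries k) := by
        conv_lhs => rw [hd]
        exact MvPowerSeries.coeff_embDomain_rename π.toEmbedding _ _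
      rw [key, coeff_powerSumSeries, coeff_powerSumSeries]
      refine if_congr ⟨?_, ?_⟩ rfl rfl
      · rintro ⟨i, hi⟩
        refine ⟨π i, ?_⟩
        rw [hd, hi, Finsupp.embDomain_single]
        rfl
      · rintro ⟨i, rfl⟩
        exact ⟨π.symm i, by simp⟩
    · rw [coeff_powerSumSeries] at hd
      by_cases h : ∃ i, d = Finsupp.single i k
      · obtain ⟨i, rfl⟩ := h
        simp
      · simp [h] at hd⟩

/-- The Frobenius characteristic of a finite-dimensional complex representation of the symmetric
group of a finite set `V` with `n` elements:
`ch ρ = (1 / n!) ∑_{σ ∈ 𝔖_V} χ_ρ(σ) p_{type σ} = ∑_{μ ⊢ n} χ_ρ(μ) z_μ⁻¹ p_μ`,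
where `p_μ = p_{μ_1} p_{μ_2} ⋯`. It is additive in `ρ`, and on the Specht module indexed by `lam`
it is the Schur function `s_lam = ∑_μ χ^lam(μ) z_μ⁻¹ p_μ`. -/
def frobeniusChar {V M : Type*} [Fintype V] [DecidableEq V] [AddCommGroup M] [Module ℂ M]
    (ρ : Representation ℂ (Equiv.Perm V) M) : SymFun :=
  ((Nat.factorial (Fintype.card V) : ℂ)⁻¹) •
    ∑ σ : Equiv.Perm V, ρ.character σ • (σ.partition.parts.map powerSum).prod

/-! ### The graded modules attached to a set partition

A partition of `V` into blocks is given by an equivalence relation `r : Setoid V`. -/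

section Blocks

variable {V : Type*}

/-- The Young subgroup `𝔖_{B_1} × ⋯ × 𝔖_{B_k} ≤ 𝔖_V` of the permutations that map every block
of `r` to itself. -/
def youngSubgroup (r : Setoid V) : Subgroup (Equiv.Perm V) where
  carrier := {σ | ∀ x, r (σ x) x}
  one_mem' x := r.refl x
  mul_mem' {σ τ} hσ hτ x := r.trans (hσ (τ x)) (hτ x)
  inv_mem' {σ} hσ x := by
    have h := hσ (σ⁻¹ x)
    have e : σ (σ⁻¹ x) = x := σ.apply_symm_apply x
    rw [e] at h
    exact r.symm h

theorem youngSubgroup_mono {r s : Setoid V} (h : s ≤ r) : youngSubgroup s ≤ youngSubgroup r :=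
  fun _ hσ x => h (hσ x)

variable [Fintype V]

open Classical in
/-- The sum of the values of `v` over the block of `x`. -/
def blockSum (r : Setoid V) (v : V → ℂ) (x : V) : ℂ := ∑ y with r y x, v y

open Classical in
/-- The number of elements of the block of `x`. -/
def blockSize (r : Setoid V) (x : V) : ℕ := (Finset.univ.filter fun y => r y x).card

theorem blockSum_congr (r : Setoid V) (v : V → ℂ) {x y : V} (h : r x y) :
    blockSum r v x = blockSum r v y := by
  classical
  unfold blockSum
  congr 1
  ext z
  simp only [Finset.mem_filter, Finset.mem_univ, true_and]
  exact ⟨fun hz => r.trans hz h, fun hz => r.trans hz (r.symm h)⟩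

theorem blockSize_congr (r : Setoid V) {x y : V} (h : r x y) :
    blockSize r x = blockSize r y := by
  classical
  unfold blockSize
  congr 1
  ext z
  simp only [Finset.mem_filter, Finset.mem_univ, true_and]
  exact ⟨fun hz => r.trans hz h, fun hz => r.trans hz (r.symm h)⟩

theorem blockSize_pos (r : Setoid V) (x : V) : 0 < blockSize r x := by
  classical
  exact Finset.card_pos.mpr ⟨x, by simp⟩

/-- The functions `V → ℂ` whose values sum to zero over every block. As a representation of the
Young subgroup this is `⨁_k 𝒮^{(b_k - 1, 1)}`, where the block `B_k` has `b_k` elements and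
`𝒮^{(b - 1, 1)}` is realized as the sum-zero vectors in the permutation representation `ℂ^b`
(the zero module if `b = 1`). -/
def SumZero (r : Setoid V) : Submodule ℂ (V → ℂ) where
  carrier := {v | ∀ x, blockSum r v x = 0}
  add_mem' hv hw x := by
    have h1 := hv x
    have h2 := hw x
    simp only [blockSum] at *
    simp [Finset.sum_add_distrib, h1, h2]
  zero_mem' x := by simp [blockSum]
  smul_mem' c v hv x := by
    have h1 := hv x
    simp only [blockSum] at *
    simp [← Finset.mul_sum, h1]

/-- The Young subgroup acts on `SumZero r` by permuting coordinates. -/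
def sumZeroRep (r : Setoid V) : Representation ℂ (youngSubgroup r) (SumZero r) where
  toFun σ := (LinearMap.funLeft ℂ ℂ (⇑(σ⁻¹ : Equiv.Perm V))).restrict fun v hv x => by
    classical
    have hx := hv x
    unfold blockSum at hx ⊢
    rw [← hx]
    refine Finset.sum_equiv (σ⁻¹ : Equiv.Perm V) (fun y => ?_) (fun y _ => rfl)
    have hy : r ((σ⁻¹ : Equiv.Perm V) y) y := (youngSubgroup r).inv_mem σ.2 y
    simp only [Finset.mem_filter, Finset.mem_univ, true_and]
    exact ⟨fun h => r.trans hy h, fun h => r.trans (r.symm hy) h⟩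
  map_one' := by ext; simp
  map_mul' σ τ := by ext; simp

/-- The degree `j` part of `ℒ_{b_1} ⊗ ⋯ ⊗ ℒ_{b_k} = ⋀^*(⨁_k 𝒮^{(b_k - 1, 1)})`, where
`ℒ_b = ⋀^* 𝒮^{(b - 1, 1)}`, as a representation of the Young subgroup. -/
def extRep (r : Setoid V) (j : ℕ) :
    Representation ℂ (youngSubgroup r) (⋀[ℂ]^j (SumZero r)) where
  toFun σ := exteriorPower.map j (sumZeroRep r σ)
  map_one' := by
    rw [map_one]
    exact exteriorPower.map_id
  map_mul' σ τ := by
    rw [map_mul, Module.End.mul_eq_comp, Module.End.mul_eq_comp]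
    exact exteriorPower.map_comp (sumZeroRep r τ) (sumZeroRep r σ)

/-- The degree `j` part of `Ind (ℒ_{b_1} ⊗ ⋯ ⊗ ℒ_{b_k})`, induced from the Young subgroup of `r`
to `𝔖_V`. For the finite group `𝔖_V` the induced module is modelled, as usual, by the equivariant
functions `f : 𝔖_V → ⋀^j`, `f (g σ) = g • f σ` for `g` in the Young subgroup. -/
def BlockModule (r : Setoid V) (j : ℕ) : Type _ :=
  Representation.coindV (youngSubgroup r).subtype (extRep r j)

instance (r : Setoid V) (j : ℕ) : AddCommGroup (BlockModule r j) :=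
  inferInstanceAs (AddCommGroup (Representation.coindV (youngSubgroup r).subtype (extRep r j)))

instance (r : Setoid V) (j : ℕ) : Module ℂ (BlockModule r j) :=
  inferInstanceAs (Module ℂ (Representation.coindV (youngSubgroup r).subtype (extRep r j)))

/-- The action of `𝔖_V` on the induced module `BlockModule r j`. -/
def blockRep (r : Setoid V) (j : ℕ) : Representation ℂ (Equiv.Perm V) (BlockModule r j) :=
  Representation.coind (youngSubgroup r).subtype (extRep r j)

/-- Subtracting from `v` its average over each block of `s`. This is the equivariant projection
onto `SumZero s` that is the identity on `SumZero s` and kills the functions which are constant on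
the blocks of `s`. -/
def center (s : Setoid V) : (V → ℂ) →ₗ[ℂ] SumZero s where
  toFun v := ⟨fun x => v x - blockSum s v x / blockSize s x, fun x => by
    classical
    have hne : (blockSize s x : ℂ) ≠ 0 := by exact_mod_cast (blockSize_pos s x).ne'
    have h1 : ∑ y with s y x, blockSum s v y / (blockSize s y : ℂ) =
        ∑ y with s y x, blockSum s v x / (blockSize s x : ℂ) := by
      refine Finset.sum_congr rfl fun y hy => ?_
      have hy' : s y x := (Finset.mem_filter.mp hy).2
      rw [blockSum_congr s v hy', blockSize_congr s hy']
    have h2 : ((Finset.univ.filter fun y => s y x).card : ℂ) = blockSize s x := rfl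
    have h3 : ∑ y with s y x, v y = blockSum s v x := rfl
    change ∑ y with s y x, (v y - blockSum s v y / (blockSize s y : ℂ)) = 0
    rw [Finset.sum_sub_distrib, h1, Finset.sum_const, nsmul_eq_mul, h2, h3]
    field_simp
    simp⟩
  map_add' v w := by
    ext x
    simp [blockSum, Finset.sum_add_distrib]
    ring
  map_smul' c v := by
    ext x
    simp [blockSum, ← Finset.mul_sum]
    ring

/-- The projection `⨁_k 𝒮^{(b_k - 1, 1)} → ⨁_l 𝒮^{(c_l - 1, 1)}` for a refinement `s` of `r`. If a
block `B` of `r` is split into two blocks `A`, `A'` of `s`, it is the identity on the summand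
`𝒯 = 𝒮^{(a - 1, 1)} ⊕ 𝒮^{(a' - 1, 1)}` of `Res 𝒮^{(b - 1, 1)} = 𝒯 ⊕ 𝟏`, and zero on `𝟏`. If `s = r`,
it is the identity. -/
def split (r s : Setoid V) : SumZero r →ₗ[ℂ] SumZero s := center s ∘ₗ (SumZero r).subtype

theorem center_perm (s : Setoid V) (σ : youngSubgroup s) (v : V → ℂ) :
    center s (LinearMap.funLeft ℂ ℂ (⇑(σ⁻¹ : Equiv.Perm V)) v) = sumZeroRep s σ (center s v) := by
  classical
  ext x
  have hσ : s ((σ⁻¹ : Equiv.Perm V) x) x := (youngSubgroup s).inv_mem σ.2 x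
  have h1 : blockSum s (LinearMap.funLeft ℂ ℂ (⇑(σ⁻¹ : Equiv.Perm V)) v) x = blockSum s v x := by
    unfold blockSum
    refine Finset.sum_equiv (σ⁻¹ : Equiv.Perm V) (fun y => ?_) (fun y _ => rfl)
    have hy : s ((σ⁻¹ : Equiv.Perm V) y) y := (youngSubgroup s).inv_mem σ.2 y
    simp only [Finset.mem_filter, Finset.mem_univ, true_and]
    exact ⟨fun h => s.trans hy h, fun h => s.trans (s.symm hy) h⟩
  change v ((σ⁻¹ : Equiv.Perm V) x) -
      blockSum s (LinearMap.funLeft ℂ ℂ (⇑(σ⁻¹ : Equiv.Perm V)) v) x / blockSize s x =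
    v ((σ⁻¹ : Equiv.Perm V) x) -
      blockSum s v ((σ⁻¹ : Equiv.Perm V) x) / blockSize s ((σ⁻¹ : Equiv.Perm V) x)
  rw [h1, blockSum_congr s v hσ, blockSize_congr s hσ]

/-- The per-edge map for a refinement `s ≤ r`: the `𝔖_V`-linear map
`Ind_r ⋀^j(⨁_k 𝒮^{(b_k - 1, 1)}) → Ind_s ⋀^j(⨁_l 𝒮^{(c_l - 1, 1)})` that corresponds to
`⋀^j (split r s)` under Frobenius reciprocity and transitivity of induction. It is the identity if
`s = r`. -/
def blockMap {r s : Setoid V} (h : s ≤ r) (j : ℕ) : BlockModule r j →ₗ[ℂ] BlockModule s j :=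
  ((exteriorPower.map j (split r s)).compLeft (Equiv.Perm V)).restrict fun f hf g σ => by
    have hg := hf ⟨g.1, youngSubgroup_mono h g.2⟩ σ
    have hcomm : split r s ∘ₗ sumZeroRep r ⟨g.1, youngSubgroup_mono h g.2⟩ =
        sumZeroRep s g ∘ₗ split r s :=
      LinearMap.ext fun v => center_perm s g v.1
    change exteriorPower.map j (split r s) (f (g.1 * σ)) =
      exteriorPower.map j (sumZeroRep s g) (exteriorPower.map j (split r s) (f σ))
    have h1 := exteriorPower.map_comp (n := j) (split r s) (sumZeroRep s g)
    have h2 := exteriorPower.map_comp (n := j)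
      (sumZeroRep r ⟨g.1, youngSubgroup_mono h g.2⟩) (split r s)
    rw [hcomm] at h2
    refine (congrArg (exteriorPower.map j (split r s)) hg).trans ?_
    exact LinearMap.congr_fun (h2.symm.trans h1) (f σ)

end Blocks

/-! ### The chain complex of a graph

`G` is a finite multigraph (loops and multiple edges are allowed), with edges
`ω 0, …, ω (m - 1)`; a state is a set `F` of (indices of) edges. -/

section Complex

variable {α β : Type*} (G : Graph α β) {m : ℕ} (ω : Fin m ≃ E(G))

/-- The partition of the vertices into the connected components of the spanning subgraph with edge
set `F`. -/
def components (F : Finset (Fin m)) : Setoid V(G) :=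
  Relation.EqvGen.setoid fun x y => ∃ k ∈ F, G.IsLink (ω k) x y

theorem components_mono {F F' : Finset (Fin m)} (h : F' ⊆ F) :
    components G ω F' ≤ components G ω F := by
  intro x y hxy
  exact Relation.EqvGen.mono (fun (x y : V(G)) (hl : ∃ k ∈ F', G.IsLink (ω k) x y) =>
    (⟨hl.choose, h hl.choose_spec.1, hl.choose_spec.2⟩ : ∃ k ∈ F, G.IsLink (ω k) x y)) x y hxy

variable [Fintype V(G)]

/-- The degree `j` part `(ℳ_F)_j` of the graded module of the state `F`. -/
abbrev StateModule (F : Finset (Fin m)) (j : ℕ) : Type _ := BlockModule (components G ω F) j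

/-- The chain module `C_{i,j}(G) = ⨁_{|F| = i} (ℳ_F)_j`. -/
abbrev Chain (i j : ℕ) : Type _ :=
  (F : {F : Finset (Fin m) // F.card = i}) → StateModule G ω F.1 j

/-- The action of the symmetric group of the vertex set on `C_{i,j}(G)`. -/
def chainRep (i j : ℕ) : Representation ℂ (Equiv.Perm V(G)) (Chain G ω i j) where
  toFun σ := LinearMap.pi fun F => blockRep (components G ω F.1) j σ ∘ₗ LinearMap.proj F
  map_one' := by
    refine LinearMap.ext fun c => funext fun F => ?_
    simp
  map_mul' σ τ := by
    refine LinearMap.ext fun c => funext fun F => ?_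
    simp

/-- The differential `d_{i+1,j} : C_{i+1,j}(G) → C_{i,j}(G)`. Its component at the state `F` is the
sum over the edges `e ∉ F` of `(-1)^k d_ε`, where `d_ε : ℳ_{F ∪ e} → ℳ_F` is the per-edge map and `k`
is the number of edges after `e` that are not in `F`. -/
def diff (i j : ℕ) : Chain G ω (i + 1) j →ₗ[ℂ] Chain G ω i j :=
  LinearMap.pi fun F => ∑ e : {e : Fin m // e ∉ F.1},
    ((-1 : ℂ) ^ (Finset.univ.filter fun k => e.1 < k ∧ k ∉ F.1).card) •
      (blockMap (components_mono G ω (Finset.subset_insert e.1 F.1)) j ∘ₗ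
        LinearMap.proj (⟨insert e.1 F.1, by rw [Finset.card_insert_of_notMem e.2, F.2]⟩ :
          {F' : Finset (Fin m) // F'.card = i + 1}))

theorem diff_equivariant (i j : ℕ) (σ : Equiv.Perm V(G)) (c : Chain G ω (i + 1) j) :
    diff G ω i j (chainRep G ω (i + 1) j σ c) = chainRep G ω i j σ (diff G ω i j c) := by
  funext F
  simp only [diff, chainRep, LinearMap.pi_apply, LinearMap.sum_apply, LinearMap.smul_apply,
    LinearMap.comp_apply, LinearMap.proj_apply, MonoidHom.coe_mk, OneHom.coe_mk, map_sum, map_smul]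
  rfl

/-- The kernel of `d_{i,j}`, where `d_{0,j} = 0`. -/
def cycles (j : ℕ) : (i : ℕ) → Submodule ℂ (Chain G ω i j)
  | 0 => ⊤
  | i + 1 => LinearMap.ker (diff G ω i j)

theorem cycles_invariant (i j : ℕ) (σ : Equiv.Perm V(G)) :
    cycles G ω j i ≤ (cycles G ω j i).comap (chainRep G ω i j σ) := by
  cases i with
  | zero => exact fun _ _ => trivial
  | succ i =>
    intro c hc
    have hc' : diff G ω i j c = 0 := hc
    change diff G ω i j (chainRep G ω (i + 1) j σ c) = 0
    rw [diff_equivariant, hc', map_zero]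

/-- The action of the symmetric group of the vertex set on the kernel of `d_{i,j}`. -/
def cyclesRep (i j : ℕ) : Representation ℂ (Equiv.Perm V(G)) (cycles G ω j i) :=
  (chainRep G ω i j).subrepresentation (cycles G ω j i) (cycles_invariant G ω i j)

/-- The image of `d_{i+1,j}`, as a submodule of the kernel of `d_{i,j}`. -/
def boundaries (i j : ℕ) : Submodule ℂ (cycles G ω j i) :=
  (LinearMap.range (diff G ω i j)).submoduleOf (cycles G ω j i)

/-- The chromatic symmetric homology `H_{i,j}(G) = ker d_{i,j} / im d_{i+1,j}`. -/
abbrev Homology (i j : ℕ) : Type _ := cycles G ω j i ⧸ boundaries G ω i j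

/-- The action of the symmetric group of the vertex set on `H_{i,j}(G)`. -/
def homologyRep (i j : ℕ) : Representation ℂ (Equiv.Perm V(G)) (Homology G ω i j) :=
  (cyclesRep G ω i j).quotient (boundaries G ω i j) fun σ z hz => by
    obtain ⟨c, hc⟩ : ∃ c, diff G ω i j c = (z : Chain G ω i j) := hz
    exact ⟨chainRep G ω (i + 1) j σ c, by rw [diff_equivariant, hc]; rfl⟩

open Classical in
/-- The bigraded Frobenius series
`Frob_G(q,t) = ∑_{i,j ≥ 0} (-1)^{i+j} t^i q^j ch (H_{i,j}(G))`, as a power series over the ring of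
symmetric functions in two variables, of which number `0` is `q` and number `1` is `t`. -/
def frobeniusSeries : MvPowerSeries (Fin 2) SymFun :=
  fun d => (-1 : SymFun) ^ (d 1 + d 0) * frobeniusChar (homologyRep G ω (d 1) (d 0))

end Complex

/-! ### Disjoint unions -/

/-- The disjoint union `A + B` of two graphs. -/
def disjointUnion {α β α' β' : Type*} (A : Graph α β) (B : Graph α' β') :
    Graph (α ⊕ α') (β ⊕ β') where
  vertexSet := Sum.inl '' V(A) ∪ Sum.inr '' V(B)
  IsLink
    | .inl e, .inl x, .inl y => A.IsLink e x y
    | .inr e, .inr x, .inr y => B.IsLink e x y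
    | _, _, _ => False
  edgeSet := Sum.inl '' E(A) ∪ Sum.inr '' E(B)
  isLink_symm := by
    rintro (e | e) - <;> refine ⟨?_⟩ <;> rintro (x | x) (y | y) h
    all_goals first | exact h.elim | exact Graph.IsLink.symm h
  eq_or_eq_of_isLink_of_isLink := by
    rintro (e | e) (x | x) (y | y) (v | v) (w | w) h h'
    all_goals first
      | exact h.elim
      | exact h'.elim
      | simpa using Graph.IsLink.left_eq_or_eq h h'
  edge_mem_iff_exists_isLink := by
    rintro (e | e)
    · simp [Graph.edge_mem_iff_exists_isLink]
    · simp [Graph.edge_mem_iff_exists_isLink]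
  left_mem_of_isLink := by
    rintro (e | e) (x | x) (y | y) h
    all_goals first
      | exact h.elim
      | exact Or.inl ⟨x, Graph.IsLink.left_mem h, rfl⟩
      | exact Or.inr ⟨x, Graph.IsLink.left_mem h, rfl⟩

instance {α β α' β' : Type*} (A : Graph α β) (B : Graph α' β') [Fintype V(A)] [Fintype V(B)] :
    Fintype V(disjointUnion A B) :=
  haveI : Finite V(disjointUnion A B) :=
    (((Set.toFinite V(A)).image Sum.inl).union ((Set.toFinite V(B)).image Sum.inr)).to_subtype
  Fintype.ofFinite _

end ChromaticHomology

end

noncomputable section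

namespace ChromaticHomology

/-! ### Traces -/

section Trace

/-! The statement is a Künneth theorem for complexes of representations, combined with the
multiplicativity of the Frobenius characteristic under induction from `𝔖_{V(A)} × 𝔖_{V(B)}`.

A state `F` of `A + B` is a pair of states `(F₁, F₂)`, and its components are those of `F₁` together
with those of `F₂`. So the sum-zero functions for `F` are the direct sum of those for `F₁` and `F₂`,
the exterior power `⋀^j` becomes the sum of the `⋀^p ⊗ ⋀^q` with `p + q = j` (`wedge`), and the
Young subgroup of `F` lies in `𝔖_{V(A)} × 𝔖_{V(B)}`. By induction in stages, the total complex of `A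
+ B` in exterior degree `j` is induced from the sum of the tensor products of total complexes of `A`
and `B` (`kunneth`). This map is injective because values at states and permutations detect tensors,
and bijective by a dimension count.

The differentials match up to signs. If the edges of `A` preceded those of `B`, the signs would be
those of a tensor product of complexes; an arbitrary enumeration is corrected by multiplying the
value at `F` by the sign of the permutation that reorders the edges missing from `F`
(`edgeSign_mul_stateSign`). Exterior degrees contribute no sign, since per-edge maps preserve them
and are induced by maps of exterior algebras.

Homology is never decomposed into irreducibles. By averaging, every total complex has an equivariant
contraction `(h, π)` (`exists_isContraction`), and the character of `H_{i,j}` at `σ` is the trace of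
`σ π` on the degree `i` part (`character_homologyRep`). Contractions tensor
(`IsContraction.tensor`), coinduce and transport along isomorphisms, so the character for `A + B` is
an induced trace of a product operator. Frobenius' formula (`sum_trace_coind_smul`) rewrites its
characteristic as an average over pairs of permutations, where both the traces and the power sums of
cycle types factor. The signs `(-1)^(i+j)` are multiplicative, which gives the product of series. -/

theorem trace_pi {ι : Type*} [Fintype ι] [DecidableEq ι] {M : ι → Type*}
    [∀ i, AddCommGroup (M i)] [∀ i, Module ℂ (M i)] [∀ i, FiniteDimensional ℂ (M i)]
    (L : Module.End ℂ (∀ i, M i)) :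
    LinearMap.trace ℂ _ L =
      ∑ i, LinearMap.trace ℂ _ (LinearMap.proj i ∘ₗ L ∘ₗ LinearMap.single ℂ M i) := by
  have h : L = ∑ i, (L ∘ₗ LinearMap.single ℂ M i) ∘ₗ LinearMap.proj i := by
    refine LinearMap.ext fun c => ?_
    simp only [LinearMap.sum_apply, LinearMap.comp_apply, LinearMap.proj_apply, ← map_sum]
    congr 1
    exact (Finset.univ_sum_single c).symm
  conv_lhs => rw [h]
  rw [map_sum]
  refine Finset.sum_congr rfl fun i _ => ?_
  rw [LinearMap.trace_comp_comm']

/-- The trace on a subquotient `Z / B` of an operator `S`, from an operator `Q` with values in `Z`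
that vanishes on `B` and induces the identity on `Z / B`. -/
theorem trace_mapQ_restrict {U : Type*} [AddCommGroup U] [Module ℂ U] [FiniteDimensional ℂ U]
    (Z : Submodule ℂ U) (B : Submodule ℂ Z) (S Q : Module.End ℂ U) (hS : ∀ z ∈ Z, S z ∈ Z)
    (hSB : B ≤ B.comap (S.restrict hS)) (hQ : ∀ u, Q u ∈ Z) (hQB : ∀ z ∈ B, Q z = 0)
    (hQ1 : ∀ z : Z, z - ⟨Q z, hQ z⟩ ∈ B) :
    LinearMap.trace ℂ (Z ⧸ B) (B.mapQ B (S.restrict hS) hSB) = LinearMap.trace ℂ U (S * Q) := by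
  let q : U →ₗ[ℂ] Z := Q.codRestrict Z hQ
  -- `Q` factors through `Z` and kills `B`, so cyclicity of the trace moves the computation from `U`
  -- to `Z`, then to `Z ⧸ B`. There `s` is a section of the quotient map by `hQ1`.
  let s : Z ⧸ B →ₗ[ℂ] Z := B.liftQ (q ∘ₗ Z.subtype) fun z hz => Subtype.ext (hQB z hz)
  have h1 : S * Q = Z.subtype ∘ₗ (S.restrict hS ∘ₗ q) := rfl
  have h2 : (S.restrict hS ∘ₗ q) ∘ₗ Z.subtype = (S.restrict hS ∘ₗ s) ∘ₗ B.mkQ := rfl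
  rw [h1, LinearMap.trace_comp_comm', h2, LinearMap.trace_comp_comm']
  congr 1
  refine Submodule.linearMap_qext _ (LinearMap.ext fun z => ?_)
  change B.mkQ (S.restrict hS z) = B.mkQ (S.restrict hS (q z))
  rw [← sub_eq_zero, ← map_sub, ← map_sub, ← LinearMap.mem_ker, Submodule.ker_mkQ]
  exact hSB (hQ1 z)

end Trace

/-! ### Coinduced representations of finite groups -/

section Coind

variable {K G W : Type*} [Group K] [Group G] [AddCommGroup W] [Module ℂ W]
  (κ : K →* G) (ρ : Representation ℂ K W)

/-- The operator on the coinduced module given by an equivariant operator. -/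
def coindEnd (Q : Module.End ℂ W) (hQ : ∀ k, ρ k * Q = Q * ρ k) :
    Module.End ℂ (Representation.coindV κ ρ) :=
  (Q.compLeft G).restrict fun f hf k g => by
    change Q (f (κ k * g)) = ρ k (Q (f g))
    rw [show f (κ k * g) = ρ k (f g) from hf k g]
    exact (LinearMap.congr_fun (hQ k) (f g)).symm

variable [Fintype K]

/-- The averaging projection of all functions onto the coinduced module. -/
def coindAverage : (G → W) →ₗ[ℂ] Representation.coindV κ ρ where
  toFun f := ⟨fun g => (Fintype.card K : ℂ)⁻¹ • ∑ k, ρ k⁻¹ (f (κ k * g)), fun k g => by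
    change _ = ρ k ((Fintype.card K : ℂ)⁻¹ • ∑ k, ρ k⁻¹ (f (κ k * g)))
    rw [map_smul (ρ k), map_sum (ρ k)]
    refine congrArg _ ?_
    rw [← Equiv.sum_comp (Equiv.mulRight k) fun x => ρ k (ρ x⁻¹ (f (κ x * g)))]
    refine Finset.sum_congr rfl fun k' _ => ?_
    change _ = ρ k (ρ (k' * k)⁻¹ (f (κ (k' * k) * g)))
    rw [← Module.End.mul_apply, ← map_mul, map_mul κ]
    simp [mul_assoc]⟩
  map_add' f f' := by
    ext g
    simp [Finset.sum_add_distrib]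
  map_smul' c f := by
    ext g
    simp [Finset.smul_sum, smul_comm c]

theorem coindAverage_subtype (f : Representation.coindV κ ρ) : coindAverage κ ρ f.1 = f := by
  ext g
  change (Fintype.card K : ℂ)⁻¹ • ∑ k, ρ k⁻¹ (f.1 (κ k * g)) = f.1 g
  have h : ∀ k, ρ k⁻¹ (f.1 (κ k * g)) = f.1 g := fun k => by
    rw [f.2 k g, ← Module.End.mul_apply, ← map_mul]
    simp
  rw [Finset.sum_congr rfl fun k _ => h k, Finset.sum_const, Finset.card_univ,
    ← Nat.cast_smul_eq_nsmul ℂ, smul_smul, inv_mul_cancel₀ (by simp), one_smul]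

variable [Fintype G] [DecidableEq G] [FiniteDimensional ℂ W]

/-- `coindAverage` makes the coinduced module a retract of the space of all functions `G → W`. The
trace can therefore be taken there, where it is the sum over `x` of the diagonal blocks, read off on
functions supported at `x`. -/
theorem trace_coind (Q : Module.End ℂ W) (hQ : ∀ k, ρ k * Q = Q * ρ k) (g : G) :
    LinearMap.trace ℂ _ (Representation.coind κ ρ g * coindEnd κ ρ Q hQ) =
      (Fintype.card K : ℂ)⁻¹ *
        ∑ x : G, ∑ k, if κ k * (x * g) = x then LinearMap.trace ℂ W (Q * ρ k⁻¹) else 0 := by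
  set X := Representation.coind κ ρ g * coindEnd κ ρ Q hQ
  have h1 : X = (X ∘ₗ coindAverage κ ρ) ∘ₗ (Representation.coindV κ ρ).subtype :=
    LinearMap.ext fun f => congrArg X (coindAverage_subtype κ ρ f).symm
  rw [h1, LinearMap.trace_comp_comm', trace_pi, Finset.mul_sum]
  refine Finset.sum_congr rfl fun x _ => ?_
  have h2 : LinearMap.proj x ∘ₗ ((Representation.coindV κ ρ).subtype ∘ₗ X ∘ₗ coindAverage κ ρ) ∘ₗ
      LinearMap.single ℂ (fun _ : G => W) x =
      (Fintype.card K : ℂ)⁻¹ • ∑ k, if κ k * (x * g) = x then Q * ρ k⁻¹ else 0 := by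
    refine LinearMap.ext fun w => ?_
    change Q ((Fintype.card K : ℂ)⁻¹ • ∑ k, ρ k⁻¹ ((Pi.single x w : G → W) (κ k * (x * g)))) = _
    rw [map_smul, map_sum, LinearMap.smul_apply, LinearMap.sum_apply]
    congr 1
    refine Finset.sum_congr rfl fun k _ => ?_
    rw [Pi.single_apply]
    split_ifs <;> simp
  rw [h2, map_smul, map_sum, smul_eq_mul]
  congr 1
  refine Finset.sum_congr rfl fun k _ => ?_
  split_ifs <;> simp

/-- Frobenius' formula for induced characters, integrated against a class function. -/
theorem sum_trace_coind_smul {R : Type*} [AddCommGroup R] [Module ℂ R] (p : G → R)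
    (hp : ∀ g x, p (x * g * x⁻¹) = p g) (Q : Module.End ℂ W) (hQ : ∀ k, ρ k * Q = Q * ρ k) :
    (Fintype.card G : ℂ)⁻¹ • ∑ g, LinearMap.trace ℂ _
        (Representation.coind κ ρ g * coindEnd κ ρ Q hQ) • p g =
      (Fintype.card K : ℂ)⁻¹ • ∑ k, LinearMap.trace ℂ W (Q * ρ k) • p (κ k) := by
  have h1 : ∀ x : G, ∀ k, ∑ g, (if κ k * (x * g) = x then LinearMap.trace ℂ W (Q * ρ k⁻¹) else 0) •
      p g = LinearMap.trace ℂ W (Q * ρ k⁻¹) • p (κ k⁻¹) := fun x k => by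
    -- The equation `κ k * (x * g) = x` has only this solution. It is conjugate to `κ k⁻¹`, so the
    -- class function `p` takes a value independent of `x`, and the sum over `x` merely cancels the
    -- order of `G`.
    rw [Finset.sum_eq_single (x⁻¹ * (κ k)⁻¹ * x)]
    · rw [if_pos (by group)]
      have := hp (κ k⁻¹) x⁻¹
      rw [inv_inv, map_inv κ] at this
      rw [this, map_inv κ]
    · intro g _ hg
      rw [if_neg, zero_smul]
      intro h
      apply hg
      rw [mul_assoc, eq_inv_mul_iff_mul_eq, eq_inv_mul_iff_mul_eq, h]
    · simp
  have h2 : ∑ g, LinearMap.trace ℂ _ (Representation.coind κ ρ g * coindEnd κ ρ Q hQ) • p g =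
      (Fintype.card K : ℂ)⁻¹ • ∑ _x : G, ∑ k, LinearMap.trace ℂ W (Q * ρ k) • p (κ k) := by
    simp only [trace_coind, mul_smul, Finset.sum_smul, ← Finset.smul_sum]
    congr 1
    rw [Finset.sum_comm]
    refine Finset.sum_congr rfl fun x _ => ?_
    rw [Finset.sum_comm, Finset.sum_congr rfl fun k _ => h1 x k]
    exact Fintype.sum_equiv (Equiv.inv K) _ _ fun k => rfl
  rw [h2, Finset.sum_const, Finset.card_univ, smul_comm, ← Nat.cast_smul_eq_nsmul ℂ, smul_smul,
    smul_smul, mul_assoc, inv_mul_cancel₀ (by simp), mul_one]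

/-- This is the trace of the identity: in `trace_coind` at `g = 1`, injectivity of `κ` leaves only
the term `k = 1` for each `x`. -/
theorem finrank_coindV (hκ : Function.Injective κ) :
    (Fintype.card K : ℂ) * Module.finrank ℂ (Representation.coindV κ ρ) =
      Fintype.card G * Module.finrank ℂ W := by
  have h := trace_coind κ ρ 1 (fun k => by simp) 1
  have h1 : Representation.coind κ ρ 1 * coindEnd κ ρ 1 (fun k => by simp) = 1 := by
    rw [map_one, one_mul]
    rfl
  rw [h1, LinearMap.trace_one] at h
  have h2 : ∀ x : G, ∑ k, (if κ k * (x * 1) = x then LinearMap.trace ℂ W (1 * ρ k⁻¹) else 0) =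
      Module.finrank ℂ W := fun x => by
    rw [Finset.sum_eq_single 1]
    · simp
    · intro k _ hk
      rw [if_neg]
      intro h
      apply hk
      apply hκ
      simpa using h
    · simp
  rw [h, Finset.sum_congr rfl fun x _ => h2 x, Finset.sum_const, Finset.card_univ, nsmul_eq_mul,
    mul_inv_cancel_left₀ (by simp)]

end Coind

/-! ### Contractions of a graded differential module onto its homology -/

section Contraction

variable {T : Type*} [AddCommGroup T] [Module ℂ T]

/-- A graded module with differential `D` of degree `-1` is contracted by `h`, of degree `1`, onto
the image of the chain map `π`, where `D` vanishes. The grading is given by the operators `e w`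
that multiply the part of degree `i` by `w i`. -/
structure IsContraction (D : Module.End ℂ T) (e : (ℕ → ℂ) → Module.End ℂ T)
    (h π : Module.End ℂ T) : Prop where
  D_mul_π : D * π = 0
  π_mul_D : π * D = 0
  one_sub : 1 - π = D * h + h * D
  h_mul : ∀ w, h * e (fun i => w (i + 1)) = e w * h
  π_mul : ∀ w, π * e w = e w * π

/-- Every linear map has a generalized inverse. -/
theorem exists_mul_mul_eq {K V W : Type*} [Field K] [AddCommGroup V] [Module K V] [AddCommGroup W]
    [Module K W] (f : V →ₗ[K] W) : ∃ g : W →ₗ[K] V, f ∘ₗ g ∘ₗ f = f := by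
  obtain ⟨s, hs⟩ := f.rangeRestrict.exists_rightInverse_of_surjective f.range_rangeRestrict
  obtain ⟨p, hp⟩ := (LinearMap.range f).subtype.exists_leftInverse_of_injective
    (Submodule.ker_subtype _)
  refine ⟨s ∘ₗ p, LinearMap.ext fun v => ?_⟩
  have h1 : p (f v) = f.rangeRestrict v := LinearMap.congr_fun hp (f.rangeRestrict v)
  have h2 : f.rangeRestrict (s (f.rangeRestrict v)) = f.rangeRestrict v :=
    LinearMap.congr_fun hs _
  change f (s (p (f v))) = f v
  rw [h1]
  exact congrArg Subtype.val h2

/-- An equivariant differential on a graded representation of a finite group has an equivariant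
contraction onto its homology. -/
theorem exists_isContraction {G : Type*} [Group G] [Fintype G] (ρ : Representation ℂ G T)
    (D : Module.End ℂ T) (e : (ℕ → ℂ) →ₐ[ℂ] Module.End ℂ T) (N : ℕ)
    (hN : ∑ i ∈ Finset.range N, e (Pi.single i 1) = 1) (hDD : D * D = 0)
    (hDe : ∀ w, D * e w = e (fun i => w (i + 1)) * D)
    (hρD : ∀ g, ρ g * D = D * ρ g) (hρe : ∀ g w, ρ g * e w = e w * ρ g) :
    ∃ h π, IsContraction D e h π ∧ (∀ g, ρ g * h = h * ρ g) ∧ ∀ g, ρ g * π = π * ρ g := by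
  obtain ⟨h0, hh0⟩ : ∃ h0 : Module.End ℂ T, D * (h0 * D) = D := exists_mul_mul_eq D
  have hw : ∀ (w : ℕ → ℂ) i, e w * e (Pi.single i 1) = w i • e (Pi.single i 1) := fun w i => by
    rw [← map_mul, ← map_smul]
    congr 1
    ext k
    by_cases hk : k = i <;> simp [hk]
  have hw' : ∀ (w : ℕ → ℂ) i, e (Pi.single i 1) * e w = w i • e (Pi.single i 1) := fun w i => by
    rw [← hw, ← map_mul, ← map_mul, mul_comm]
  have hs : ∀ i, (fun k => (Pi.single (i + 1) 1 : ℕ → ℂ) (k + 1)) = Pi.single i 1 := fun i => by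
    ext k
    by_cases hk : k = i <;> simp [hk]
  -- The part of the generalized inverse `h0` that is homogeneous of degree `1`. Since `D` has
  -- degree `-1`, this part alone still satisfies `D h1 D = D`.
  set h1 : Module.End ℂ T :=
    ∑ i ∈ Finset.range N, e (Pi.single (i + 1) 1) * (h0 * e (Pi.single i 1))
    with h1_def
  have h1e : ∀ w, h1 * e (fun i => w (i + 1)) = e w * h1 := fun w => by
    rw [h1_def, Finset.sum_mul, Finset.mul_sum]
    refine Finset.sum_congr rfl fun i _ => ?_
    rw [mul_assoc, mul_assoc, hw', ← mul_assoc (e w), hw, mul_smul_comm, mul_smul_comm,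
      smul_mul_assoc]
  have h1D : D * (h1 * D) = D := by
    rw [h1_def, Finset.sum_mul, Finset.mul_sum]
    have : ∀ i ∈ Finset.range N, D * (e (Pi.single (i + 1) 1) * (h0 * e (Pi.single i 1)) * D) =
        e (Pi.single i 1) * D := fun i _ => by
      have h2 : e (Pi.single i 1) * D = D * e (Pi.single (i + 1) 1) := by rw [hDe, hs]
      have h3 := hw (Pi.single i 1) i
      rw [Pi.single_eq_same, one_smul] at h3
      calc D * (e (Pi.single (i + 1) 1) * (h0 * e (Pi.single i 1)) * D)
          = D * e (Pi.single (i + 1) 1) * (h0 * (e (Pi.single i 1) * D)) := by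
            simp only [mul_assoc]
        _ = e (Pi.single i 1) * (D * (h0 * D)) * e (Pi.single (i + 1) 1) := by
            rw [← h2]
            simp only [mul_assoc]
            rw [h2]
        _ = e (Pi.single i 1) * D := by rw [hh0, mul_assoc, ← h2, ← mul_assoc, h3]
    rw [Finset.sum_congr rfl this, ← Finset.sum_mul, hN, one_mul]
  have hρ : ∀ g, ρ g * ρ g⁻¹ = 1 := fun g => by rw [← map_mul, mul_inv_cancel, map_one]
  have hρ' : ∀ g, ρ g⁻¹ * ρ g = 1 := fun g => by rw [← map_mul, inv_mul_cancel, map_one]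
  have hcard : (Fintype.card G : ℂ)⁻¹ • ∑ _g : G, D = D := by
    rw [Finset.sum_const, Finset.card_univ, ← Nat.cast_smul_eq_nsmul ℂ, smul_smul,
      inv_mul_cancel₀ (by simp), one_smul]
  -- Averaging makes `h1` equivariant. As `D` and the grading commute with `G`, the degree and the
  -- relation `D h D = D` survive.
  set h : Module.End ℂ T := (Fintype.card G : ℂ)⁻¹ • ∑ g, ρ g * (h1 * ρ g⁻¹) with h_def
  have hρh : ∀ g, ρ g * h = h * ρ g := fun g => by
    rw [h_def, mul_smul_comm, smul_mul_assoc, Finset.mul_sum, Finset.sum_mul]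
    congr 1
    refine Fintype.sum_equiv (Equiv.mulLeft g) _ _ fun x => ?_
    change _ = ρ (g * x) * (h1 * ρ (g * x)⁻¹) * ρ g
    rw [mul_inv_rev, map_mul, map_mul]
    simp only [mul_assoc, hρ', mul_one]
  have hhe : ∀ w, h * e (fun i => w (i + 1)) = e w * h := fun w => by
    rw [h_def, mul_smul_comm, smul_mul_assoc, Finset.mul_sum, Finset.sum_mul]
    congr 1
    refine Finset.sum_congr rfl fun g _ => ?_
    rw [mul_assoc, mul_assoc, hρe, ← mul_assoc h1, h1e, ← mul_assoc (e w), ← hρe]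
    simp only [mul_assoc]
  have hhD : D * (h * D) = D := by
    conv_rhs => rw [← hcard]
    rw [h_def, smul_mul_assoc, mul_smul_comm, Finset.sum_mul, Finset.mul_sum]
    congr 1
    refine Finset.sum_congr rfl fun g _ => ?_
    rw [mul_assoc, mul_assoc, hρD, ← mul_assoc D, ← hρD, mul_assoc, ← mul_assoc h1,
      ← mul_assoc D, h1D, ← hρD, ← mul_assoc, hρ, one_mul]
  -- `D h D = D` and `D D = 0` give `D π = π D = 0`. Idempotency of `π` is not part of
  -- `IsContraction`, so `h` needs no further normalization.
  refine ⟨h, 1 - (D * h + h * D), ⟨?_, ?_, ?_, hhe, fun w => ?_⟩, hρh, fun g => ?_⟩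
  · rw [mul_sub, mul_add, ← mul_assoc, hDD, hhD, zero_mul, zero_add, mul_one, sub_self]
  · rw [sub_mul, add_mul, mul_assoc, hhD, mul_assoc, hDD, mul_zero, add_zero, one_mul, sub_self]
  · abel
  · have h3 : D * h * e w = e w * (D * h) := by
      -- Truncated subtraction inverts the shift, because `i + 1 - 1 = i`; the value that it assigns
      -- to degree `0` cancels out.
      have h4 := hhe fun i => w (i - 1)
      have h5 := hDe fun i => w (i - 1)
      simp only [add_tsub_cancel_right] at h4 h5
      rw [mul_assoc, h4, ← mul_assoc, h5, mul_assoc]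
    rw [sub_mul, mul_sub, add_mul, mul_add, h3, mul_assoc h D, hDe, ← mul_assoc h,
      hhe, mul_assoc (e w) h, mul_one, one_mul]
  · rw [mul_sub, sub_mul, mul_add, add_mul, ← mul_assoc, hρD, mul_assoc, hρh, ← mul_assoc (ρ g),
      hρh, mul_assoc h, hρD, mul_one, one_mul]
    simp only [mul_assoc]

theorem IsContraction.conj {T' : Type*} [AddCommGroup T'] [Module ℂ T'] {D : Module.End ℂ T}
    {e : (ℕ → ℂ) → Module.End ℂ T} {h π : Module.End ℂ T} (H : IsContraction D e h π)
    (Ψ : T ≃ₗ[ℂ] T') {D' : Module.End ℂ T'} {e' : (ℕ → ℂ) → Module.End ℂ T'}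
    (hD : ∀ c, Ψ (D c) = D' (Ψ c)) (he : ∀ w c, Ψ (e w c) = e' w (Ψ c)) :
    IsContraction D' e' (Ψ.conj h) (Ψ.conj π) := by
  have hD' : D' = Ψ.conj D := LinearMap.ext fun c => by
    rw [LinearEquiv.conj_apply_apply, hD, Ψ.apply_symm_apply]
  have he' : e' = fun w => Ψ.conj (e w) := funext fun w => LinearMap.ext fun c => by
    rw [LinearEquiv.conj_apply_apply, he, Ψ.apply_symm_apply]
  subst hD' he'
  have hm : ∀ f g : Module.End ℂ T, Ψ.conj f * Ψ.conj g = Ψ.conj (f * g) := fun f g =>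
    (LinearEquiv.conj_comp Ψ g f).symm
  refine ⟨?_, ?_, ?_, fun w => ?_, fun w => ?_⟩
  · rw [hm, H.D_mul_π, map_zero]
  · rw [hm, H.π_mul_D, map_zero]
  · rw [hm, hm, ← map_add, ← H.one_sub, map_sub]
    congr 1
    exact (LinearEquiv.conj_id Ψ).symm
  · rw [hm, hm, H.h_mul]
  · rw [hm, hm, H.π_mul]

theorem IsContraction.coind {K G : Type*} [Group K] [Group G] (κ : K →* G)
    (ρ : Representation ℂ K T) {D : Module.End ℂ T}
    {e : (ℕ → ℂ) → Module.End ℂ T} {h π : Module.End ℂ T} (H : IsContraction D e h π)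
    (hD : ∀ k, ρ k * D = D * ρ k) (he : ∀ w k, ρ k * e w = e w * ρ k)
    (hh : ∀ k, ρ k * h = h * ρ k) (hπ : ∀ k, ρ k * π = π * ρ k) :
    IsContraction (coindEnd κ ρ D hD) (fun w => coindEnd κ ρ (e w) (he w)) (coindEnd κ ρ h hh)
      (coindEnd κ ρ π hπ) where
  D_mul_π := LinearMap.ext fun f => Subtype.ext <| funext fun g =>
    LinearMap.congr_fun H.D_mul_π (f.1 g)
  π_mul_D := LinearMap.ext fun f => Subtype.ext <| funext fun g =>
    LinearMap.congr_fun H.π_mul_D (f.1 g)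
  one_sub := LinearMap.ext fun f => Subtype.ext <| funext fun g =>
    LinearMap.congr_fun H.one_sub (f.1 g)
  h_mul w := LinearMap.ext fun f => Subtype.ext <| funext fun g =>
    LinearMap.congr_fun (H.h_mul w) (f.1 g)
  π_mul w := LinearMap.ext fun f => Subtype.ext <| funext fun g =>
    LinearMap.congr_fun (H.π_mul w) (f.1 g)

/-- The operator on a product given by operators on the factors. -/
def piEnd {ι : Type*} {M : ι → Type*} [∀ i, AddCommGroup (M i)] [∀ i, Module ℂ (M i)] :
    (∀ i, Module.End ℂ (M i)) →* Module.End ℂ (∀ i, M i) where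
  toFun f := LinearMap.pi fun i => f i ∘ₗ LinearMap.proj i
  map_one' := rfl
  map_mul' _ _ := rfl

theorem trace_piEnd {ι : Type*} [Fintype ι] {M : ι → Type*} [∀ i, AddCommGroup (M i)]
    [∀ i, Module ℂ (M i)] [∀ i, FiniteDimensional ℂ (M i)] (f : ∀ i, Module.End ℂ (M i)) :
    LinearMap.trace ℂ _ (piEnd f) = ∑ i, LinearMap.trace ℂ _ (f i) := by
  classical
  rw [trace_pi]
  refine Finset.sum_congr rfl fun i _ => ?_
  congr 1
  refine LinearMap.ext fun c => ?_
  change f i ((Pi.single i c : ∀ i, M i) i) = f i c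
  rw [Pi.single_eq_same]

theorem IsContraction.pi {ι : Type*} {M : ι → Type*} [∀ i, AddCommGroup (M i)]
    [∀ i, Module ℂ (M i)] {D : ∀ i, Module.End ℂ (M i)} {e : ∀ i, (ℕ → ℂ) → Module.End ℂ (M i)}
    {h π : ∀ i, Module.End ℂ (M i)} (H : ∀ i, IsContraction (D i) (e i) (h i) (π i)) :
    IsContraction (piEnd D) (fun w => piEnd fun i => e i w) (piEnd h) (piEnd π) where
  D_mul_π := LinearMap.ext fun c => funext fun i => LinearMap.congr_fun (H i).D_mul_π (c i)
  π_mul_D := LinearMap.ext fun c => funext fun i => LinearMap.congr_fun (H i).π_mul_D (c i)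
  one_sub := LinearMap.ext fun c => funext fun i => LinearMap.congr_fun (H i).one_sub (c i)
  h_mul w := LinearMap.ext fun c => funext fun i => LinearMap.congr_fun ((H i).h_mul w) (c i)
  π_mul w := LinearMap.ext fun c => funext fun i => LinearMap.congr_fun ((H i).π_mul w) (c i)

open TensorProduct in
/-- The grading operators of a tensor product, the second factor of which has degrees `< N`. -/
def tensorGrading {T' : Type*} [AddCommGroup T'] [Module ℂ T'] (e : (ℕ → ℂ) → Module.End ℂ T)
    (e' : (ℕ → ℂ) → Module.End ℂ T') (N : ℕ) (w : ℕ → ℂ) : Module.End ℂ (T ⊗[ℂ] T') :=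
  ∑ k ∈ Finset.range N, TensorProduct.map (e fun i => w (i + k)) (e' (Pi.single k 1))

/-- The Künneth theorem, for contractions. -/
theorem IsContraction.tensor {T' : Type*} [AddCommGroup T'] [Module ℂ T'] {D : Module.End ℂ T}
    {e : (ℕ → ℂ) →ₐ[ℂ] Module.End ℂ T} {h π : Module.End ℂ T} (H : IsContraction D e h π)
    {D' : Module.End ℂ T'} {e' : (ℕ → ℂ) →ₐ[ℂ] Module.End ℂ T'} {h' π' : Module.End ℂ T'}
    (H' : IsContraction D' e' h' π') (N : ℕ)
    (hN : ∑ i ∈ Finset.range N, e' (Pi.single i 1) = 1)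
    (hDe : ∀ w, D' * e' w = e' (fun i => w (i + 1)) * D')
    {s : ℕ → ℂ} (hs : ∀ i, s (i + 1) = -s i) (hss : ∀ i, s i * s i = 1) :
    IsContraction (TensorProduct.map D (e' s) + TensorProduct.map 1 D') (tensorGrading e e' N)
      (TensorProduct.map h (e' s) + TensorProduct.map π h') (TensorProduct.map π π') := by
  have hss' : e' s * e' s = 1 := by
    rw [← map_mul, ← map_one e']
    congr 1
    exact funext hss
  have hsD : D' * e' s = -(e' s * D') := by
    rw [hDe, show (fun i => s (i + 1)) = -s from funext hs, map_neg, neg_mul]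
  have hcomm : ∀ v w, e' v * e' w = e' w * e' v := fun v w => by
    rw [← map_mul, ← map_mul, mul_comm]
  -- The projection to degree `N` is orthogonal to those of degrees `< N`, which already sum to `1`.
  have hlast : e' (Pi.single N 1) = 0 := by
    rw [← one_mul (e' _), ← hN, Finset.sum_mul]
    refine Finset.sum_eq_zero fun i hi => ?_
    rw [← map_mul, ← map_zero e']
    congr 1
    ext k
    have := (Finset.mem_range.mp hi).ne
    by_cases hk : k = i <;> simp_all
  have hfirst : e' (Pi.single 0 1) * h' = 0 := by
    rw [← H'.h_mul]
    have : (fun i => (Pi.single 0 1 : ℕ → ℂ) (i + 1)) = 0 := by ext; simp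
    rw [this, map_zero, mul_zero]
  have hshift : ∀ k, h' * e' (Pi.single k 1) = e' (Pi.single (k + 1) 1) * h' := fun k => by
    rw [← H'.h_mul]
    congr 2
    ext i
    by_cases hk : i = k <;> simp [hk]
  refine ⟨?_, ?_, ?_, fun w => ?_, fun w => ?_⟩
  · rw [add_mul, ← TensorProduct.map_mul, ← TensorProduct.map_mul, H.D_mul_π, H'.D_mul_π,
      TensorProduct.map_zero_left, TensorProduct.map_zero_right, add_zero]
  · rw [mul_add, ← TensorProduct.map_mul, ← TensorProduct.map_mul, H.π_mul_D, H'.π_mul_D,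
      TensorProduct.map_zero_left, TensorProduct.map_zero_right, add_zero]
  -- After this splitting, expand the anticommutator of the differential and the homotopy: the terms
  -- with `D π` and `π D` vanish, those with `D' s + s D'` cancel because `s` alternates, and `s s =
  -- 1` leaves exactly the two summands.
  · have h1 : (1 : Module.End ℂ (TensorProduct ℂ T T')) - TensorProduct.map π π' =
        TensorProduct.map (1 - π) 1 + TensorProduct.map π (1 - π') := by
      refine TensorProduct.ext' fun x y => ?_
      simp [TensorProduct.sub_tmul, TensorProduct.tmul_sub]
    rw [h1, H.one_sub, H'.one_sub]
    simp only [add_mul, mul_add, ← TensorProduct.map_mul, H.D_mul_π, H.π_mul_D, hss', hsD,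
      one_mul, mul_one, TensorProduct.map_zero_left, TensorProduct.map_add_left,
      TensorProduct.map_add_right]
    have h2 : TensorProduct.map h (-(e' s * D')) = -TensorProduct.map h (e' s * D') := by
      refine TensorProduct.ext' fun x y => ?_
      simp [TensorProduct.tmul_neg]
    rw [h2]
    abel
  · rw [tensorGrading, tensorGrading, add_mul, mul_add]
    congr 1
    · rw [Finset.mul_sum, Finset.sum_mul]
      refine Finset.sum_congr rfl fun k _ => ?_
      rw [← TensorProduct.map_mul, ← TensorProduct.map_mul, hcomm s,
        ← H.h_mul fun i => w (i + k)]
      simp only [add_right_comm]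
    · rw [Finset.mul_sum, Finset.sum_mul]
      -- `h'` raises the second degree, so the two sums match after `k ↦ k + 1`. The extra terms at
      -- `k = 0` and `k = N` vanish by `hfirst` and `hlast`.
      have h1 := Finset.sum_range_succ' (fun k => TensorProduct.map (e fun i => w (i + k))
        (e' (Pi.single k 1)) * TensorProduct.map π h') N
      rw [Finset.sum_range_succ] at h1
      simp only [← TensorProduct.map_mul, hlast, hfirst, zero_mul, TensorProduct.map_zero_right,
        add_zero] at h1 ⊢
      rw [h1]
      refine Finset.sum_congr rfl fun k _ => ?_
      rw [hshift, H.π_mul]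
      simp only [add_assoc, add_comm, add_left_comm]
  · rw [tensorGrading, Finset.mul_sum, Finset.sum_mul]
    refine Finset.sum_congr rfl fun k _ => ?_
    rw [← TensorProduct.map_mul, ← TensorProduct.map_mul, H.π_mul, H'.π_mul]

end Contraction

/-! ### Exterior powers of a direct sum -/

section Wedge

open TensorProduct

variable {M N P : Type*} [AddCommGroup M] [Module ℂ M] [AddCommGroup N] [Module ℂ N]
  [AddCommGroup P] [Module ℂ P]

theorem coe_exteriorPower_map (u : M →ₗ[ℂ] N) (j : ℕ) (x : ⋀[ℂ]^j M) :
    (exteriorPower.map j u x : ExteriorAlgebra ℂ N) = ExteriorAlgebra.map u x := by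
  have h : (⋀[ℂ]^j N).subtype ∘ₗ exteriorPower.map j u =
      (ExteriorAlgebra.map u).toLinearMap ∘ₗ (⋀[ℂ]^j M).subtype := by
    refine exteriorPower.linearMap_ext ?_
    ext m
    simp [ExteriorAlgebra.map_apply_ιMulti, Function.comp_def]
  exact LinearMap.congr_fun h x

/-- The pairs of degrees with sum `j`. -/
abbrev Bidegree (j : ℕ) : Type := Finset.HasAntidiagonal.antidiagonal j

/-- The product `⋀^i M ⊗ ⋀^k N → ⋀^j P`, `i + k = j`, for linear maps `u : M → P`, `v : N → P`. -/
def wedgeMul (u : M →ₗ[ℂ] P) (v : N →ₗ[ℂ] P) {j : ℕ} (p : Bidegree j) :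
    (⋀[ℂ]^p.1.1 M) ⊗[ℂ] (⋀[ℂ]^p.1.2 N) →ₗ[ℂ] ⋀[ℂ]^j P :=
  ((TensorProduct.lift (LinearMap.mul ℂ (ExteriorAlgebra ℂ P))) ∘ₗ
    TensorProduct.map ((⋀[ℂ]^p.1.1 P).subtype ∘ₗ exteriorPower.map p.1.1 u)
      ((⋀[ℂ]^p.1.2 P).subtype ∘ₗ exteriorPower.map p.1.2 v)).codRestrict _ fun x => by
    induction x with
    | zero => rw [map_zero]; exact zero_mem _
    | add x y hx hy => rw [map_add]; exact add_mem hx hy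
    | tmul x y =>
      have h := SetLike.mul_mem_graded (A := fun i : ℕ => ⋀[ℂ]^i P)
        (exteriorPower.map p.1.1 u x).2 (exteriorPower.map p.1.2 v y).2
      rwa [Finset.HasAntidiagonal.mem_antidiagonal.mp p.2] at h

theorem coe_wedgeMul_tmul (u : M →ₗ[ℂ] P) (v : N →ₗ[ℂ] P) {j : ℕ} (p : Bidegree j)
    (x : ⋀[ℂ]^p.1.1 M) (y : ⋀[ℂ]^p.1.2 N) :
    (wedgeMul u v p (x ⊗ₜ y) : ExteriorAlgebra ℂ P) =
      ExteriorAlgebra.map u x * ExteriorAlgebra.map v y := by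
  rw [← coe_exteriorPower_map, ← coe_exteriorPower_map]
  rfl

theorem map_wedgeMul {M' N' P' : Type*} [AddCommGroup M'] [Module ℂ M'] [AddCommGroup N']
    [Module ℂ N'] [AddCommGroup P'] [Module ℂ P'] {u : M →ₗ[ℂ] P} {v : N →ₗ[ℂ] P}
    {u' : M' →ₗ[ℂ] P'} {v' : N' →ₗ[ℂ] P'} {f : M →ₗ[ℂ] M'} {g : N →ₗ[ℂ] N'} {k : P →ₗ[ℂ] P'}
    (hu : k ∘ₗ u = u' ∘ₗ f) (hv : k ∘ₗ v = v' ∘ₗ g) {j : ℕ} (p : Bidegree j)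
    (z : (⋀[ℂ]^p.1.1 M) ⊗[ℂ] (⋀[ℂ]^p.1.2 N)) :
    exteriorPower.map j k (wedgeMul u v p z) =
      wedgeMul u' v' p (TensorProduct.map (exteriorPower.map _ f) (exteriorPower.map _ g) z) := by
  induction z with
  | zero => simp only [map_zero]
  | add x y hx hy => simp only [map_add, hx, hy]
  | tmul x y =>
    apply Subtype.ext
    rw [coe_exteriorPower_map, coe_wedgeMul_tmul, TensorProduct.map_tmul, coe_wedgeMul_tmul,
      coe_exteriorPower_map, coe_exteriorPower_map, map_mul]
    simp only [← AlgHom.comp_apply, ExteriorAlgebra.map_comp_map, hu, hv]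

/-- The sum of the products `⋀^i M ⊗ ⋀^k N → ⋀^j P` over `i + k = j`. -/
def wedge (u : M →ₗ[ℂ] P) (v : N →ₗ[ℂ] P) (j : ℕ) :
    ((p : Bidegree j) → (⋀[ℂ]^p.1.1 M) ⊗[ℂ] (⋀[ℂ]^p.1.2 N)) →ₗ[ℂ] ⋀[ℂ]^j P :=
  ∑ p, wedgeMul u v p ∘ₗ LinearMap.proj p

theorem wedge_apply (u : M →ₗ[ℂ] P) (v : N →ₗ[ℂ] P) (j : ℕ)
    (z : (p : Bidegree j) → (⋀[ℂ]^p.1.1 M) ⊗[ℂ] (⋀[ℂ]^p.1.2 N)) :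
    wedge u v j z = ∑ p, wedgeMul u v p (z p) := by
  simp [wedge]

theorem map_wedge {M' N' P' : Type*} [AddCommGroup M'] [Module ℂ M'] [AddCommGroup N']
    [Module ℂ N'] [AddCommGroup P'] [Module ℂ P'] {u : M →ₗ[ℂ] P} {v : N →ₗ[ℂ] P}
    {u' : M' →ₗ[ℂ] P'} {v' : N' →ₗ[ℂ] P'} {f : M →ₗ[ℂ] M'} {g : N →ₗ[ℂ] N'} {k : P →ₗ[ℂ] P'}
    (hu : k ∘ₗ u = u' ∘ₗ f) (hv : k ∘ₗ v = v' ∘ₗ g) (j : ℕ)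
    (z : (p : Bidegree j) → (⋀[ℂ]^p.1.1 M) ⊗[ℂ] (⋀[ℂ]^p.1.2 N)) :
    exteriorPower.map j k (wedge u v j z) = wedge u' v' j fun p =>
      TensorProduct.map (exteriorPower.map _ f) (exteriorPower.map _ g) (z p) := by
  simp only [wedge_apply, map_sum, map_wedgeMul hu hv]

/-- Submodules absorb signs, so anticommuting subspaces commute as elements of the semiring of
submodules, and the binomial theorem applies to them. -/
theorem mul_le_of_anticommute {A : Type*} [Ring A] [Algebra ℂ A] {p q : Submodule ℂ A}
    (h : ∀ x ∈ p, ∀ y ∈ q, x * y = -(y * x)) : p * q ≤ q * p := by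
  rw [Submodule.mul_le]
  intro x hx y hy
  rw [h x hx y hy]
  exact neg_mem (Submodule.mul_mem_mul hy hx)

theorem map_ι_range_pow (f : M →ₗ[ℂ] P) (i : ℕ) :
    (LinearMap.range f).map (ExteriorAlgebra.ι ℂ) ^ i =
      (⋀[ℂ]^i M : Submodule ℂ (ExteriorAlgebra ℂ M)).map (ExteriorAlgebra.map f).toLinearMap := by
  change _ = (LinearMap.range (ExteriorAlgebra.ι ℂ) ^ i).map _
  rw [Submodule.map_pow, ← LinearMap.range_comp, ← LinearMap.range_comp,
    ExteriorAlgebra.map_comp_ι]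

/-- `⋀^j P` is the `j`-th power of the subspace `P` of the exterior algebra, and `P` is the sum of
the commuting subspaces `p` and `q`. Binomial expansion exhibits `⋀^j P` as the sum of the products
`p^i q^k` with `i + k = j`. -/
theorem wedge_surjective {u : M →ₗ[ℂ] P} {v : N →ₗ[ℂ] P}
    (h : LinearMap.range u ⊔ LinearMap.range v = ⊤) (j : ℕ) :
    Function.Surjective (wedge u v j) := by
  classical
  let p : Submodule ℂ (ExteriorAlgebra ℂ P) := (LinearMap.range u).map (ExteriorAlgebra.ι ℂ)
  let q : Submodule ℂ (ExteriorAlgebra ℂ P) := (LinearMap.range v).map (ExteriorAlgebra.ι ℂ)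
  have hanti : ∀ x y : P, ExteriorAlgebra.ι ℂ x * ExteriorAlgebra.ι ℂ y =
      -(ExteriorAlgebra.ι ℂ y * ExteriorAlgebra.ι ℂ x) := fun x y =>
    eq_neg_of_add_eq_zero_left (ExteriorAlgebra.ι_add_mul_swap x y)
  have hcomm : Commute p q := by
    refine le_antisymm (mul_le_of_anticommute ?_) (mul_le_of_anticommute ?_)
    · rintro _ ⟨x, -, rfl⟩ _ ⟨y, -, rfl⟩
      exact hanti x y
    · rintro _ ⟨x, -, rfl⟩ _ ⟨y, -, rfl⟩
      exact hanti x y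
  have hpow : (⋀[ℂ]^j P : Submodule ℂ (ExteriorAlgebra ℂ P)) = (p + q) ^ j := by
    change LinearMap.range (ExteriorAlgebra.ι ℂ) ^ j = _
    congr 1
    rw [Submodule.add_eq_sup, ← Submodule.map_sup, h, Submodule.map_top]
  have key : (⋀[ℂ]^j P : Submodule ℂ (ExteriorAlgebra ℂ P)) ≤
      (LinearMap.range (wedge u v j)).map (⋀[ℂ]^j P).subtype := by
    refine hpow.le.trans ?_
    rw [hcomm.add_pow']
    refine Finset.sum_induction _ (· ≤ _) (fun _ _ => sup_le) bot_le fun m hm => ?_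
    -- A natural multiple of a submodule is a repeated supremum; written as a constant sum it is
    -- bounded term by term.
    rw [← Finset.card_range (j.choose m.1), ← Finset.sum_const]
    refine Finset.sum_induction _ (· ≤ _) (fun _ _ => sup_le) bot_le fun _ _ => ?_
    rw [map_ι_range_pow, map_ι_range_pow, Submodule.mul_le]
    rintro _ ⟨x, hx, rfl⟩ _ ⟨y, hy, rfl⟩
    refine ⟨_, ⟨Pi.single (⟨m, hm⟩ : Bidegree j) (⟨x, hx⟩ ⊗ₜ ⟨y, hy⟩), rfl⟩, ?_⟩
    rw [wedge_apply, Finset.sum_eq_single (⟨m, hm⟩ : Bidegree j), Pi.single_eq_same]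
    · exact coe_wedgeMul_tmul u v ⟨m, hm⟩ ⟨x, hx⟩ ⟨y, hy⟩
    · intro p _ hp
      rw [Pi.single_eq_of_ne hp, map_zero]
    · simp
  intro y
  obtain ⟨x, ⟨z, rfl⟩, hx⟩ := key y.2
  exact ⟨z, Subtype.ext hx⟩

variable [FiniteDimensional ℂ M] [FiniteDimensional ℂ N]

/-- Dimensions of exterior powers are binomial coefficients, so this is Vandermonde's identity. -/
theorem finrank_exteriorPower_eq_sum [FiniteDimensional ℂ P]
    (hrank : Module.finrank ℂ P = Module.finrank ℂ M + Module.finrank ℂ N) (j : ℕ) :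
    Module.finrank ℂ (⋀[ℂ]^j P) =
      ∑ p : Bidegree j, Module.finrank ℂ (⋀[ℂ]^p.1.1 M) * Module.finrank ℂ (⋀[ℂ]^p.1.2 N) := by
  rw [exteriorPower.finrank_eq, hrank, Nat.add_choose_eq,
    ← Finset.sum_coe_sort (Finset.HasAntidiagonal.antidiagonal j) fun p : ℕ × ℕ =>
      (Module.finrank ℂ M).choose p.1 * (Module.finrank ℂ N).choose p.2]
  refine Finset.sum_congr rfl fun p _ => ?_
  rw [exteriorPower.finrank_eq, exteriorPower.finrank_eq]

theorem finrank_wedge (hrank : Module.finrank ℂ P = Module.finrank ℂ M + Module.finrank ℂ N)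
    [FiniteDimensional ℂ P] (j : ℕ) :
    Module.finrank ℂ ((p : Bidegree j) → (⋀[ℂ]^p.1.1 M) ⊗[ℂ] (⋀[ℂ]^p.1.2 N)) =
      Module.finrank ℂ (⋀[ℂ]^j P) := by
  rw [Module.finrank_pi_fintype, finrank_exteriorPower_eq_sum hrank]
  exact Finset.sum_congr rfl fun p _ => Module.finrank_tensorProduct

theorem wedge_injective [FiniteDimensional ℂ P] {u : M →ₗ[ℂ] P} {v : N →ₗ[ℂ] P}
    (h : LinearMap.range u ⊔ LinearMap.range v = ⊤)
    (hrank : Module.finrank ℂ P = Module.finrank ℂ M + Module.finrank ℂ N) (j : ℕ) :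
    Function.Injective (wedge u v j) :=
  (LinearMap.injective_iff_surjective_of_finrank_eq_finrank
    (V := (p : Bidegree j) → (⋀[ℂ]^p.1.1 M) ⊗[ℂ] (⋀[ℂ]^p.1.2 N)) (V₂ := ⋀[ℂ]^j P)
    (finrank_wedge hrank j)).mpr
    (wedge_surjective h j)

end Wedge

/-! ### Partitions of a disjoint union -/

section DisjointUnion

variable {V V₁ V₂ : Type*}

/-- The block permutations of a disjoint union. -/
def sumPerm (e : V₁ ⊕ V₂ ≃ V) : Equiv.Perm V₁ × Equiv.Perm V₂ →* Equiv.Perm V :=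
  e.permCongrHom.toMonoidHom.comp (Equiv.Perm.sumCongrHom V₁ V₂)

@[simp]
theorem sumPerm_inl (e : V₁ ⊕ V₂ ≃ V) (g : Equiv.Perm V₁ × Equiv.Perm V₂) (x : V₁) :
    sumPerm e g (e (Sum.inl x)) = e (Sum.inl (g.1 x)) := by
  simp [sumPerm, Equiv.permCongrHom]

@[simp]
theorem sumPerm_inr (e : V₁ ⊕ V₂ ≃ V) (g : Equiv.Perm V₁ × Equiv.Perm V₂) (y : V₂) :
    sumPerm e g (e (Sum.inr y)) = e (Sum.inr (g.2 y)) := by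
  simp [sumPerm, Equiv.permCongrHom]

theorem sumPerm_injective (e : V₁ ⊕ V₂ ≃ V) : Function.Injective (sumPerm e) :=
  e.permCongrHom.injective.comp Equiv.Perm.sumCongrHom_injective

theorem sumPerm_swap (e : V₁ ⊕ V₂ ≃ V) (g : Equiv.Perm V₁ × Equiv.Perm V₂) :
    sumPerm ((Equiv.sumComm V₂ V₁).trans e) g.swap = sumPerm e g := by
  ext v
  obtain ⟨x | y, rfl⟩ := e.surjective v
  · have := sumPerm_inr ((Equiv.sumComm V₂ V₁).trans e) g.swap x
    simpa using this
  · have := sumPerm_inl ((Equiv.sumComm V₂ V₁).trans e) g.swap y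
    simpa using this

/-- The partition `r` of the disjoint union is the union of the partitions `r₁` and `r₂`. -/
structure IsSum (e : V₁ ⊕ V₂ ≃ V) (r : Setoid V) (r₁ : Setoid V₁) (r₂ : Setoid V₂) : Prop where
  inl_iff : ∀ x y, r (e (Sum.inl x)) (e (Sum.inl y)) ↔ r₁ x y
  inr_iff : ∀ x y, r (e (Sum.inr x)) (e (Sum.inr y)) ↔ r₂ x y
  not_rel : ∀ x y, ¬ r (e (Sum.inl x)) (e (Sum.inr y))

variable {e : V₁ ⊕ V₂ ≃ V} {r : Setoid V} {r₁ : Setoid V₁} {r₂ : Setoid V₂}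

/-- With `sumPerm_swap`, this symmetry yields the facts about the second part from those about the
first. -/
theorem IsSum.symm (h : IsSum e r r₁ r₂) : IsSum ((Equiv.sumComm V₂ V₁).trans e) r r₂ r₁ :=
  ⟨h.inr_iff, h.inl_iff, fun x y hr => h.not_rel y x (r.symm hr)⟩

theorem IsSum.sumPerm_mem (h : IsSum e r r₁ r₂) (g : Equiv.Perm V₁ × Equiv.Perm V₂) :
    sumPerm e g ∈ youngSubgroup r ↔ g.1 ∈ youngSubgroup r₁ ∧ g.2 ∈ youngSubgroup r₂ := by
  refine ⟨fun hg => ⟨fun x => ?_, fun y => ?_⟩, fun hg v => ?_⟩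
  · have := hg (e (Sum.inl x))
    rwa [sumPerm_inl, h.inl_iff] at this
  · have := hg (e (Sum.inr y))
    rwa [sumPerm_inr, h.inr_iff] at this
  · obtain ⟨x | y, rfl⟩ := e.surjective v
    · rw [sumPerm_inl, h.inl_iff]
      exact hg.1 x
    · rw [sumPerm_inr, h.inr_iff]
      exact hg.2 y

/-- No block meets both parts, so a permutation preserving the blocks preserves each part. This
containment of the Young subgroup in the block permutations is what allows induction in stages. -/
theorem IsSum.exists_sumPerm_eq [Finite V₁] [Finite V₂] (h : IsSum e r r₁ r₂) {g : Equiv.Perm V}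
    (hg : g ∈ youngSubgroup r) : ∃ g', sumPerm e g' = g := by
  have h1 : e.permCongrHom.symm g ∈ (Equiv.Perm.sumCongrHom V₁ V₂).range := by
    refine Equiv.Perm.mem_sumCongrHom_range_of_perm_mapsTo_inl ?_
    rintro _ ⟨x, rfl⟩
    have h2 := hg (e (Sum.inl x))
    obtain ⟨z, hz⟩ := e.surjective (g (e (Sum.inl x)))
    have h3 : e.permCongrHom.symm g (Sum.inl x) = z := by
      change e.symm (g (e (Sum.inl x))) = z
      rw [← hz, e.symm_apply_apply]
    rw [h3]
    rw [← hz] at h2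
    rcases z with z | z
    · exact ⟨z, rfl⟩
    · exact absurd (r.symm h2) (h.not_rel x z)
  obtain ⟨g', hg'⟩ := h1
  refine ⟨g', ?_⟩
  change e.permCongrHom (Equiv.Perm.sumCongrHom V₁ V₂ g') = g
  rw [hg', MulEquiv.apply_symm_apply]

theorem IsSum.card_youngSubgroup [Finite V₁] [Finite V₂] (h : IsSum e r r₁ r₂) :
    Nat.card (youngSubgroup r) = Nat.card (youngSubgroup r₁) * Nat.card (youngSubgroup r₂) := by
  rw [← Nat.card_prod]
  refine (Nat.card_congr (Equiv.ofBijective (fun g : youngSubgroup r₁ × youngSubgroup r₂ =>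
    (⟨sumPerm e (g.1, g.2), (h.sumPerm_mem _).mpr ⟨g.1.2, g.2.2⟩⟩ : youngSubgroup r))
    ⟨fun g g' hg => ?_, fun g => ?_⟩)).symm
  · have := sumPerm_injective e (congrArg Subtype.val hg)
    rw [Prod.mk.injEq] at this
    exact Prod.ext (Subtype.ext this.1) (Subtype.ext this.2)
  · obtain ⟨g', hg'⟩ := h.exists_sumPerm_eq g.2
    have := (h.sumPerm_mem g').mp (hg' ▸ g.2)
    exact ⟨(⟨g'.1, this.1⟩, ⟨g'.2, this.2⟩), Subtype.ext hg'⟩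

/-- Extension of functions by zero. -/
def extendZero (e : V₁ ⊕ V₂ ≃ V) : (V₁ → ℂ) →ₗ[ℂ] (V → ℂ) where
  toFun f v := Sum.elim f (fun _ => 0) (e.symm v)
  map_add' f f' := by
    ext v
    obtain ⟨x | y, rfl⟩ := e.surjective v <;> simp
  map_smul' c f := by
    ext v
    obtain ⟨x | y, rfl⟩ := e.surjective v <;> simp

@[simp]
theorem extendZero_inl (f : V₁ → ℂ) (x : V₁) : extendZero e f (e (Sum.inl x)) = f x := by
  simp [extendZero]

@[simp]
theorem extendZero_inr (f : V₁ → ℂ) (y : V₂) : extendZero e f (e (Sum.inr y)) = 0 := by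
  simp [extendZero]

variable [Fintype V] [Fintype V₁] [Fintype V₂]

theorem IsSum.blockSum_inl (h : IsSum e r r₁ r₂) (f : V → ℂ) (x : V₁) :
    blockSum r f (e (Sum.inl x)) = blockSum r₁ (fun z => f (e (Sum.inl z))) x := by
  classical
  unfold blockSum
  rw [Finset.sum_filter, Finset.sum_filter, ← Equiv.sum_comp e, Fintype.sum_sum_type]
  have h1 : ∀ y, ¬ r (e (Sum.inr y)) (e (Sum.inl x)) := fun y hr => h.not_rel x y (r.symm hr)
  simp [h1, h.inl_iff]

theorem IsSum.blockSum_inr (h : IsSum e r r₁ r₂) (f : V → ℂ) (y : V₂) :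
    blockSum r f (e (Sum.inr y)) = blockSum r₂ (fun z => f (e (Sum.inr z))) y :=
  h.symm.blockSum_inl f y

theorem blockSize_eq_blockSum (s : Setoid V) (x : V) : (blockSize s x : ℂ) = blockSum s 1 x := by
  classical
  simp [blockSum, blockSize]

theorem IsSum.blockSize_inl (h : IsSum e r r₁ r₂) (x : V₁) :
    (blockSize r (e (Sum.inl x)) : ℂ) = blockSize r₁ x := by
  rw [blockSize_eq_blockSum, blockSize_eq_blockSum, h.blockSum_inl]
  rfl

theorem IsSum.extendZero_mem (h : IsSum e r r₁ r₂) {f : V₁ → ℂ} (hf : f ∈ SumZero r₁) :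
    extendZero e f ∈ SumZero r := by
  intro v
  obtain ⟨x | y, rfl⟩ := e.surjective v
  · rw [h.blockSum_inl]
    simpa using hf x
  · rw [h.blockSum_inr]
    simp [blockSum]

/-- The summand of `SumZero r` that belongs to the first part of a disjoint union. -/
def IsSum.incl (h : IsSum e r r₁ r₂) : SumZero r₁ →ₗ[ℂ] SumZero r :=
  (extendZero e).restrict fun _ hf => h.extendZero_mem hf

theorem IsSum.incl_apply_inl (h : IsSum e r r₁ r₂) (f : SumZero r₁) (x : V₁) :
    (h.incl f).1 (e (Sum.inl x)) = f.1 x := extendZero_inl _ _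

theorem IsSum.incl_apply_inr (h : IsSum e r r₁ r₂) (f : SumZero r₁) (y : V₂) :
    (h.incl f).1 (e (Sum.inr y)) = 0 := extendZero_inr _ _

/-- Averages over a block involve only the part containing it, and extension by zero has zero
averages on the other part. -/
theorem IsSum.split_comp_incl (h : IsSum e r r₁ r₂) {s : Setoid V} {s₁ : Setoid V₁}
    {s₂ : Setoid V₂} (h' : IsSum e s s₁ s₂) : split r s ∘ₗ h.incl = h'.incl ∘ₗ split r₁ s₁ := by
  refine LinearMap.ext fun f => Subtype.ext <| funext fun v => ?_
  change extendZero e f.1 v - blockSum s (extendZero e f.1) v / blockSize s v =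
    extendZero e (split r₁ s₁ f).1 v
  obtain ⟨x | y, rfl⟩ := e.surjective v
  · rw [h'.blockSum_inl, h'.blockSize_inl]
    simp only [extendZero_inl]
    rfl
  · rw [h'.blockSum_inr]
    simp [blockSum]

theorem split_self (r : Setoid V) : split r r = LinearMap.id := by
  refine LinearMap.ext fun f => Subtype.ext <| funext fun v => ?_
  change f.1 v - blockSum r f.1 v / blockSize r v = f.1 v
  rw [f.2 v, zero_div, sub_zero]

/-- The averages over `s`-blocks are constant on the finer `t`-blocks, so centering with respect to
`t` removes them. Hence removing two edges gives the same map in either order. -/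
theorem split_comp_split {r s t : Setoid V} (hts : t ≤ s) :
    split s t ∘ₗ split r s = split r t := by
  classical
  refine LinearMap.ext fun f => Subtype.ext <| funext fun v => ?_
  have h1 : blockSum t (fun x => f.1 x - blockSum s f.1 x / blockSize s x) v =
      blockSum t f.1 v - blockSize t v * (blockSum s f.1 v / blockSize s v) := by
    rw [blockSize_eq_blockSum t]
    simp only [blockSum, Finset.sum_sub_distrib, Finset.sum_mul, Pi.one_apply, one_mul]
    congr 1
    refine Finset.sum_congr rfl fun y hy => ?_
    have hy' : s y v := hts (Finset.mem_filter.mp hy).2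
    have h2 := blockSum_congr s f.1 hy'
    simp only [blockSum] at h2
    rw [h2, blockSize_congr s hy']
  change (f.1 v - blockSum s f.1 v / blockSize s v) -
    blockSum t (fun x => f.1 x - blockSum s f.1 x / blockSize s x) v / blockSize t v =
    f.1 v - blockSum t f.1 v / blockSize t v
  have hne : (blockSize t v : ℂ) ≠ 0 := by exact_mod_cast (blockSize_pos t v).ne'
  rw [h1, sub_div, mul_div_cancel_left₀ _ hne]
  ring

theorem IsSum.rep_comp_incl (h : IsSum e r r₁ r₂) (g : Equiv.Perm V₁ × Equiv.Perm V₂)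
    (g₁ : youngSubgroup r₁) (hg₁ : g₁.1 = g.1) (g' : youngSubgroup r) (hg' : g'.1 = sumPerm e g) :
    sumZeroRep r g' ∘ₗ h.incl = h.incl ∘ₗ sumZeroRep r₁ g₁ := by
  refine LinearMap.ext fun f => Subtype.ext <| funext fun v => ?_
  have h1 : (sumZeroRep r g' (h.incl f)).1 v = extendZero e f.1 (g'.1⁻¹ v) := rfl
  change (sumZeroRep r g' (h.incl f)).1 v = extendZero e (sumZeroRep r₁ g₁ f).1 v
  rw [h1, hg', ← map_inv]
  obtain ⟨x | y, rfl⟩ := e.surjective v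
  · rw [sumPerm_inl, extendZero_inl, extendZero_inl]
    change f.1 (g.1⁻¹ x) = f.1 (g₁.1⁻¹ x)
    rw [hg₁]
  · rw [sumPerm_inr, extendZero_inr, extendZero_inr]

theorem IsSum.coprod_bijective (h : IsSum e r r₁ r₂) :
    Function.Bijective (h.incl.coprod h.symm.incl) := by
  have hr : ∀ (f : SumZero r₂) x, (h.symm.incl f).1 (e (Sum.inl x)) = 0 := fun f x =>
    h.symm.incl_apply_inr f x
  have hr' : ∀ (f : SumZero r₂) y, (h.symm.incl f).1 (e (Sum.inr y)) = f.1 y := fun f y =>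
    h.symm.incl_apply_inl f y
  constructor
  · rw [injective_iff_map_eq_zero]
    rintro ⟨f₁, f₂⟩ hf
    have h1 : ∀ v, (h.incl f₁).1 v + (h.symm.incl f₂).1 v = 0 := fun v =>
      congrFun (congrArg Subtype.val hf) v
    refine Prod.ext (Subtype.ext <| funext fun x => ?_) (Subtype.ext <| funext fun y => ?_)
    · have := h1 (e (Sum.inl x))
      rwa [h.incl_apply_inl, hr, add_zero] at this
    · have := h1 (e (Sum.inr y))
      rwa [h.incl_apply_inr, hr', zero_add] at this
  · intro f
    refine ⟨(⟨fun x => f.1 (e (Sum.inl x)), fun x => ?_⟩,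
      ⟨fun y => f.1 (e (Sum.inr y)), fun y => ?_⟩), Subtype.ext <| funext fun v => ?_⟩
    · rw [← h.blockSum_inl, f.2]
    · rw [← h.blockSum_inr, f.2]
    · rw [LinearMap.coprod_apply]
      change (h.incl _).1 v + (h.symm.incl _).1 v = f.1 v
      obtain ⟨x | y, rfl⟩ := e.surjective v
      · rw [h.incl_apply_inl, hr, add_zero]
      · rw [h.incl_apply_inr, hr', zero_add]

theorem IsSum.range_sup_range (h : IsSum e r r₁ r₂) :
    LinearMap.range h.incl ⊔ LinearMap.range h.symm.incl = ⊤ := by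
  rw [← LinearMap.range_coprod, LinearMap.range_eq_top]
  exact h.coprod_bijective.2

theorem IsSum.finrank_sumZero (h : IsSum e r r₁ r₂) : Module.finrank ℂ (SumZero r) =
    Module.finrank ℂ (SumZero r₁) + Module.finrank ℂ (SumZero r₂) := by
  rw [← Module.finrank_prod]
  exact (LinearEquiv.ofBijective _ h.coprod_bijective).finrank_eq.symm

end DisjointUnion

/-! ### The total complex of a graph -/

section Eval

variable {V : Type*} [Fintype V] {r s : Setoid V} {j : ℕ}

/-- The value of an element of the induced module at a permutation. -/
def BlockModule.eval (σ : Equiv.Perm V) : BlockModule r j →ₗ[ℂ] ⋀[ℂ]^j (SumZero r) :=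
  LinearMap.proj σ ∘ₗ (Representation.coindV (youngSubgroup r).subtype (extRep r j)).subtype

theorem BlockModule.ext_eval {c c' : BlockModule r j}
    (h : ∀ σ, BlockModule.eval σ c = BlockModule.eval σ c') : c = c' :=
  Subtype.ext (funext h)

theorem BlockModule.eval_blockMap (h : s ≤ r) (σ : Equiv.Perm V) (c : BlockModule r j) :
    BlockModule.eval σ (blockMap h j c) =
      exteriorPower.map j (split r s) (BlockModule.eval σ c) := rfl

theorem BlockModule.eval_mul (g : youngSubgroup r) (σ : Equiv.Perm V) (c : BlockModule r j) :
    BlockModule.eval (g.1 * σ) c =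
      exteriorPower.map j (sumZeroRep r g) (BlockModule.eval σ c) := c.2 g σ

instance : FiniteDimensional ℂ (BlockModule r j) :=
  inferInstanceAs (FiniteDimensional ℂ
    (Representation.coindV (youngSubgroup r).subtype (extRep r j)))

theorem finrank_blockModule [DecidableEq V] (r : Setoid V) (j : ℕ) :
    (Nat.card (youngSubgroup r) : ℂ) * Module.finrank ℂ (BlockModule r j) =
      Nat.card (Equiv.Perm V) * Module.finrank ℂ (⋀[ℂ]^j (SumZero r)) := by
  classical
  have : Fintype (youngSubgroup r) := Fintype.ofFinite _
  rw [Nat.card_eq_fintype_card, Nat.card_eq_fintype_card]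
  exact finrank_coindV (youngSubgroup r).subtype (extRep r j) (Subgroup.subtype_injective _)

end Eval

/-! ### Signs of the differential -/

section EdgeSign

variable {m : ℕ}

/-- The sign of the edge `e` in the differential to the state `F`. -/
def edgeSign (F : Finset (Fin m)) (e : Fin m) : ℂ :=
  (-1 : ℂ) ^ (Finset.univ.filter fun k => e < k ∧ k ∉ F).card

theorem edgeSign_insert (F : Finset (Fin m)) {e e' : Fin m} (he' : e' ∉ F) :
    edgeSign (insert e' F) e = if e < e' then -edgeSign F e else edgeSign F e := by
  unfold edgeSign
  split_ifs with h
  · have h1 : (Finset.univ.filter fun k => e < k ∧ k ∉ F) =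
        insert e' (Finset.univ.filter fun k => e < k ∧ k ∉ insert e' F) := by
      ext k
      by_cases hk : k = e' <;> simp [hk, h, he']
    rw [h1, Finset.card_insert_of_notMem (by simp), pow_succ]
    ring
  · congr 2
    ext k
    by_cases hk : k = e' <;> simp [hk, h]

/-- Inserting an edge flips the sign of precisely the edges before it, so exactly one of the two
orders acquires an extra `-1`. -/
theorem edgeSign_mul_edgeSign (F : Finset (Fin m)) {e e' : Fin m} (he : e ∉ F) (he' : e' ∉ F)
    (hne : e ≠ e') : edgeSign F e * edgeSign (insert e F) e' =
      -(edgeSign F e' * edgeSign (insert e' F) e) := by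
  rw [edgeSign_insert F he, edgeSign_insert F he']
  rcases lt_or_gt_of_ne hne with h | h
  · rw [if_neg h.not_gt, if_pos h]
    ring
  · rw [if_neg h.not_gt, if_pos h]
    ring

end EdgeSign

theorem eq_zero_of_eq_neg {M : Type*} [AddCommGroup M] [Module ℂ M] {x : M} (h : x = -x) :
    x = 0 := by
  have h2 : (2 : ℂ) • x = 0 := by
    rw [two_smul]
    nth_rw 2 [h]
    exact add_neg_cancel x
  exact (smul_eq_zero.mp h2).resolve_left two_ne_zero

section Total

variable {α β : Type*} (G : Graph α β) {m : ℕ} (ω : Fin m ≃ E(G)) [Fintype V(G)] (j : ℕ)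

/-- The sum of the chain modules over all degrees `i`. -/
abbrev Total : Type _ := (F : Finset (Fin m)) → StateModule G ω F j

/-- The action of the symmetric group on the total complex. -/
def totalRep : Representation ℂ (Equiv.Perm V(G)) (Total G ω j) where
  toFun σ := piEnd fun F => blockRep (components G ω F) j σ
  map_one' := by
    simp only [map_one]
    exact map_one piEnd
  map_mul' σ τ := by
    simp only [map_mul]
    exact map_mul piEnd _ _

/-- The grading operators of the total complex. -/
def totalGrading : (ℕ → ℂ) →ₐ[ℂ] Module.End ℂ (Total G ω j) where
  toFun w := LinearMap.pi fun F => w F.card • LinearMap.proj F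
  map_one' := by
    refine LinearMap.ext fun c => funext fun F => ?_
    simp
  map_mul' v w := by
    refine LinearMap.ext fun c => funext fun F => ?_
    simp [mul_smul]
  map_zero' := by
    refine LinearMap.ext fun c => funext fun F => ?_
    simp
  map_add' v w := by
    refine LinearMap.ext fun c => funext fun F => ?_
    simp [add_smul]
  commutes' z := by
    refine LinearMap.ext fun c => funext fun F => ?_
    simp

@[simp]
theorem totalGrading_apply (w : ℕ → ℂ) (c : Total G ω j) (F : Finset (Fin m)) :
    totalGrading G ω j w c F = w F.card • c F := rfl

/-- The differential of the total complex. -/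
def totalDiff : Module.End ℂ (Total G ω j) :=
  LinearMap.pi fun F => ∑ e : {e : Fin m // e ∉ F}, edgeSign F e.1 •
    (blockMap (components_mono G ω (Finset.subset_insert e.1 F)) j ∘ₗ
      LinearMap.proj (insert e.1 F))

theorem totalDiff_apply (c : Total G ω j) (F : Finset (Fin m)) :
    totalDiff G ω j c F = ∑ e : {e : Fin m // e ∉ F}, edgeSign F e.1 •
      blockMap (components_mono G ω (Finset.subset_insert e.1 F)) j (c (insert e.1 F)) := by
  simp [totalDiff]

theorem eval_totalDiff_subtype (c : Total G ω j) (F : Finset (Fin m)) (σ : Equiv.Perm V(G)) :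
    BlockModule.eval σ (totalDiff G ω j c F) = ∑ e : {e : Fin m // e ∉ F}, edgeSign F e.1 •
      exteriorPower.map j (split (components G ω (insert e.1 F)) (components G ω F))
        (BlockModule.eval σ (c (insert e.1 F))) := by
  rw [totalDiff_apply, map_sum]
  exact Finset.sum_congr rfl fun e _ => by rw [map_smul, BlockModule.eval_blockMap]

/-- Summing over all edges, with zero for those in `F`, avoids an index type depending on `F` and
permits reindexing along a bijection of edges. -/
theorem eval_totalDiff (c : Total G ω j) (F : Finset (Fin m)) (σ : Equiv.Perm V(G)) :
    BlockModule.eval σ (totalDiff G ω j c F) = ∑ e : Fin m, if e ∈ F then 0 else edgeSign F e •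
      exteriorPower.map j (split (components G ω (insert e F)) (components G ω F))
        (BlockModule.eval σ (c (insert e F))) := by
  rw [eval_totalDiff_subtype, Finset.sum_ite, Finset.sum_const_zero, zero_add]
  exact (Finset.sum_subtype (Finset.univ.filter fun e => e ∉ F) (by simp) fun e => edgeSign F e •
      exteriorPower.map j (split (components G ω (insert e F)) (components G ω F))
        (BlockModule.eval σ (c (insert e F)))).symm

/-- The terms for `(e, e')` and `(e', e)` use the same composite projection, by `split_comp_split`,
with opposite signs. The double sum is thus antisymmetric and equals its own negative. -/
theorem totalDiff_mul_totalDiff : totalDiff G ω j * totalDiff G ω j = 0 := by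
  refine LinearMap.ext fun c => funext fun F => BlockModule.ext_eval fun σ => ?_
  let X : Finset (Fin m) → ⋀[ℂ]^j (SumZero (components G ω F)) := fun F' =>
    exteriorPower.map j (split (components G ω F') (components G ω F)) (BlockModule.eval σ (c F'))
  let Y : Fin m → Fin m → ⋀[ℂ]^j (SumZero (components G ω F)) := fun e e' =>
    if e ∈ F then 0 else if e' ∈ insert e F then 0 else
      (edgeSign F e * edgeSign (insert e F) e') • X (insert e' (insert e F))
  have hY : ∀ e e', Y e' e = -Y e e' := fun e e' => by
    simp only [Y]
    by_cases he : e ∈ F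
    · simp [he]
    by_cases he' : e' ∈ F
    · simp [he']
    by_cases hee : e = e'
    · simp [hee]
    rw [if_neg he, if_neg he', if_neg (by simp [he, hee]), if_neg (by simp [he', Ne.symm hee]),
      edgeSign_mul_edgeSign F he he' hee, Finset.insert_comm]
    module
  have h1 : BlockModule.eval σ ((totalDiff G ω j * totalDiff G ω j) c F) = ∑ e, ∑ e', Y e e' := by
    change BlockModule.eval σ (totalDiff G ω j (totalDiff G ω j c) F) = _
    rw [eval_totalDiff]
    refine Finset.sum_congr rfl fun e _ => ?_
    by_cases he : e ∈ F
    · simp [Y, he]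
    rw [if_neg he, eval_totalDiff, map_sum, Finset.smul_sum]
    refine Finset.sum_congr rfl fun e' _ => ?_
    simp only [Y, if_neg he]
    split_ifs with he'
    · rw [map_zero, smul_zero]
    · rw [map_smul, smul_smul, ← LinearMap.comp_apply, ← exteriorPower.map_comp,
        split_comp_split (components_mono G ω (Finset.subset_insert e F))]
  rw [h1, LinearMap.zero_apply, Pi.zero_apply, map_zero]
  have h2 : ∑ e, ∑ e', Y e e' = -∑ e, ∑ e', Y e e' := by
    conv_lhs => rw [Finset.sum_comm]
    simp only [← Finset.sum_neg_distrib, ← hY]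
  exact eq_zero_of_eq_neg h2

theorem totalDiff_mul_totalGrading (w : ℕ → ℂ) :
    totalDiff G ω j * totalGrading G ω j w =
      totalGrading G ω j (fun i => w (i + 1)) * totalDiff G ω j := by
  refine LinearMap.ext fun c => funext fun F => ?_
  change totalDiff G ω j (totalGrading G ω j w c) F = w (F.card + 1) • totalDiff G ω j c F
  rw [totalDiff_apply, totalDiff_apply, Finset.smul_sum]
  refine Finset.sum_congr rfl fun e _ => ?_
  rw [totalGrading_apply, Finset.card_insert_of_notMem e.2, map_smul, smul_comm]

theorem totalRep_mul_totalDiff (σ : Equiv.Perm V(G)) :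
    totalRep G ω j σ * totalDiff G ω j = totalDiff G ω j * totalRep G ω j σ := by
  refine LinearMap.ext fun c => funext fun F => BlockModule.ext_eval fun τ => ?_
  change BlockModule.eval (τ * σ) (totalDiff G ω j c F) =
    BlockModule.eval τ (totalDiff G ω j (totalRep G ω j σ c) F)
  rw [eval_totalDiff, eval_totalDiff]
  rfl

theorem totalRep_mul_totalGrading (σ : Equiv.Perm V(G)) (w : ℕ → ℂ) :
    totalRep G ω j σ * totalGrading G ω j w = totalGrading G ω j w * totalRep G ω j σ := by
  refine LinearMap.ext fun c => funext fun F => ?_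
  exact map_smul (blockRep (components G ω F) j σ) (w F.card) (c F)

theorem sum_totalGrading :
    ∑ i ∈ Finset.range (m + 1), totalGrading G ω j (Pi.single i 1) = 1 := by
  refine LinearMap.ext fun c => funext fun F => ?_
  rw [LinearMap.sum_apply, Finset.sum_apply, Finset.sum_eq_single F.card]
  · simp
  · intro i _ hi
    simp [Pi.single_eq_of_ne hi.symm]
  · intro h
    exact absurd (Finset.mem_range_succ_iff.mpr (card_finset_fin_le F)) h

theorem exists_total_isContraction : ∃ h π,
    IsContraction (totalDiff G ω j) (totalGrading G ω j) h π ∧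
    (∀ σ, totalRep G ω j σ * h = h * totalRep G ω j σ) ∧
    ∀ σ, totalRep G ω j σ * π = π * totalRep G ω j σ := by
  classical
  exact exists_isContraction (totalRep G ω j) (totalDiff G ω j) (totalGrading G ω j) (m + 1)
    (sum_totalGrading G ω j) (totalDiff_mul_totalDiff G ω j) (totalDiff_mul_totalGrading G ω j)
    (totalRep_mul_totalDiff G ω j) (totalRep_mul_totalGrading G ω j)

/-- The inclusion of the chains of degree `i` in the total complex. -/
def chainIncl (i : ℕ) : Chain G ω i j →ₗ[ℂ] Total G ω j where
  toFun c F := if h : F.card = i then c ⟨F, h⟩ else 0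
  map_add' c c' := by
    funext F
    by_cases h : F.card = i <;> simp [h]
  map_smul' z c := by
    funext F
    by_cases h : F.card = i <;> simp [h]

/-- The projection of the total complex to the chains of degree `i`. -/
def chainProj (i : ℕ) : Total G ω j →ₗ[ℂ] Chain G ω i j :=
  LinearMap.pi fun F => LinearMap.proj F.1

theorem chainProj_chainIncl (i : ℕ) (c : Chain G ω i j) :
    chainProj G ω j i (chainIncl G ω j i c) = c :=
  funext fun F => dif_pos F.2

theorem chainIncl_chainProj (i : ℕ) :
    chainIncl G ω j i ∘ₗ chainProj G ω j i = totalGrading G ω j (Pi.single i 1) := by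
  refine LinearMap.ext fun c => funext fun F => ?_
  change (if h : F.card = i then c F else 0) = (Pi.single i 1 : ℕ → ℂ) F.card • c F
  by_cases h : F.card = i <;> simp [h]

theorem chainProj_totalDiff (i : ℕ) (c : Total G ω j) :
    chainProj G ω j i (totalDiff G ω j c) = diff G ω i j (chainProj G ω j (i + 1) c) := by
  funext F
  change totalDiff G ω j c F.1 = _
  rw [totalDiff_apply]
  simp only [diff, LinearMap.pi_apply, LinearMap.sum_apply, LinearMap.smul_apply]
  rfl

theorem totalDiff_chainIncl_succ (i : ℕ) (c : Chain G ω (i + 1) j) :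
    totalDiff G ω j (chainIncl G ω j (i + 1) c) = chainIncl G ω j i (diff G ω i j c) := by
  have h1 : chainIncl G ω j (i + 1) c =
      totalGrading G ω j (Pi.single (i + 1) 1) (chainIncl G ω j (i + 1) c) := by
    rw [← chainIncl_chainProj, LinearMap.comp_apply, chainProj_chainIncl]
  have h2 : (fun k => (Pi.single (i + 1) 1 : ℕ → ℂ) (k + 1)) = Pi.single i 1 := by
    ext k
    by_cases hk : k = i <;> simp [hk]
  rw [h1, ← Module.End.mul_apply, totalDiff_mul_totalGrading, h2, ← chainIncl_chainProj]
  change chainIncl G ω j i (chainProj G ω j i _) = _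
  rw [chainProj_totalDiff, chainProj_chainIncl]

/-- This absorbs the separate definition of cycles in degree `0`: a state of the form `insert e F`
is nonempty, so chains of degree `0` have zero total differential. -/
theorem mem_cycles_iff (i : ℕ) (c : Chain G ω i j) :
    c ∈ cycles G ω j i ↔ totalDiff G ω j (chainIncl G ω j i c) = 0 := by
  cases i with
  | zero =>
    refine ⟨fun _ => ?_, fun _ => trivial⟩
    funext F
    rw [totalDiff_apply]
    refine Finset.sum_eq_zero fun e _ => ?_
    have h : chainIncl G ω j 0 c (insert e.1 F) = 0 := by
      refine dif_neg ?_
      rw [Finset.card_insert_of_notMem e.2]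
      exact Nat.succ_ne_zero _
    rw [h, map_zero, smul_zero]
  | succ i =>
    rw [totalDiff_chainIncl_succ]
    refine ⟨fun hc => ?_, fun hc => ?_⟩
    · rw [show diff G ω i j c = 0 from hc, map_zero]
    · change diff G ω i j c = 0
      rw [← chainProj_chainIncl G ω j i (diff G ω i j c), hc, map_zero]

theorem chainIncl_chainRep (i : ℕ) (σ : Equiv.Perm V(G)) (c : Chain G ω i j) :
    chainIncl G ω j i (chainRep G ω i j σ c) = totalRep G ω j σ (chainIncl G ω j i c) := by
  funext F
  change (if h : F.card = i then blockRep (components G ω F) j σ (c ⟨F, h⟩) else 0) =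
    blockRep (components G ω F) j σ (if h : F.card = i then c ⟨F, h⟩ else 0)
  split_ifs
  · rfl
  · rw [map_zero]

/-- The character of the homology in terms of a contraction of the total complex. -/
theorem character_homologyRep {h π : Module.End ℂ (Total G ω j)}
    (H : IsContraction (totalDiff G ω j) (totalGrading G ω j) h π) (i : ℕ)
    (σ : Equiv.Perm V(G)) :
    (homologyRep G ω i j).character σ = LinearMap.trace ℂ (Total G ω j)
      (totalRep G ω j σ * (π * totalGrading G ω j (Pi.single i 1))) := by
  have hπe : ∀ c, π (totalGrading G ω j (Pi.single i 1) c) =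
      totalGrading G ω j (Pi.single i 1) (π c) := fun c => LinearMap.congr_fun (H.π_mul _) c
  have hincl : ∀ c, totalGrading G ω j (Pi.single i 1) (chainIncl G ω j i c) =
      chainIncl G ω j i c := fun c => by
    rw [← chainIncl_chainProj, LinearMap.comp_apply, chainProj_chainIncl]
  -- The degree `i` component of `π`, which meets the conditions of `trace_mapQ_restrict`.
  let Q : Module.End ℂ (Chain G ω i j) := chainProj G ω j i ∘ₗ π ∘ₗ chainIncl G ω j i
  have hQ : ∀ c, chainIncl G ω j i (Q c) = π (chainIncl G ω j i c) := fun c => by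
    change (chainIncl G ω j i ∘ₗ chainProj G ω j i) (π (chainIncl G ω j i c)) = _
    rw [chainIncl_chainProj, ← hπe, hincl]
  have hQZ : ∀ c, Q c ∈ cycles G ω j i := fun c => by
    rw [mem_cycles_iff, hQ]
    exact LinearMap.congr_fun H.D_mul_π _
  have h1 := trace_mapQ_restrict (cycles G ω j i) (boundaries G ω i j) (chainRep G ω i j σ) Q
    (cycles_invariant G ω i j σ) (fun z hz => by
      obtain ⟨c, hc⟩ : ∃ c, diff G ω i j c = (z : Chain G ω i j) := hz
      exact ⟨chainRep G ω (i + 1) j σ c, by rw [diff_equivariant, hc]; rfl⟩) hQZ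
    (fun z hz => by
      obtain ⟨c, hc⟩ : ∃ c, diff G ω i j c = (z : Chain G ω i j) := hz
      change chainProj G ω j i (π (chainIncl G ω j i z)) = 0
      rw [← hc, ← totalDiff_chainIncl_succ]
      have := LinearMap.congr_fun H.π_mul_D (chainIncl G ω j (i + 1) c)
      rw [Module.End.mul_apply] at this
      rw [this, LinearMap.zero_apply, map_zero])
    (fun z => by
      have hz := (mem_cycles_iff G ω j i z).mp z.2
      have h2 := LinearMap.congr_fun H.one_sub (chainIncl G ω j i z)
      rw [LinearMap.add_apply, Module.End.mul_apply, Module.End.mul_apply, hz, map_zero,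
        add_zero] at h2
      -- On a cycle the homotopy identity reads `z - π z = D (h z)`.
      refine ⟨chainProj G ω j (i + 1) (h (chainIncl G ω j i z)), ?_⟩
      rw [← chainProj_totalDiff, ← h2]
      change chainProj G ω j i (chainIncl G ω j i z - π (chainIncl G ω j i z)) = z.1 - Q z.1
      rw [map_sub, chainProj_chainIncl]
      rfl)
  refine h1.trans ?_
  have h3 : chainRep G ω i j σ * Q = chainProj G ω j i ∘ₗ
      (totalRep G ω j σ * π) ∘ₗ chainIncl G ω j i := by
    refine LinearMap.ext fun c => ?_
    change chainRep G ω i j σ (Q c) =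
      chainProj G ω j i (totalRep G ω j σ (π (chainIncl G ω j i c)))
    rw [← hQ, ← chainIncl_chainRep, chainProj_chainIncl]
  rw [h3, LinearMap.trace_comp_comm', LinearMap.comp_assoc, chainIncl_chainProj]
  rfl

end Total

/-! ### States of a disjoint union -/

section States

variable {a b c : ℕ} (ε : Fin a ⊕ Fin b ≃ Fin c)

/-- The edges of a state that belong to the first part of a disjoint union. -/
def leftState (F : Finset (Fin c)) : Finset (Fin a) :=
  Finset.univ.filter fun k => ε (Sum.inl k) ∈ F

/-- The edges of a state that belong to the second part of a disjoint union. -/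
def rightState (F : Finset (Fin c)) : Finset (Fin b) :=
  Finset.univ.filter fun k => ε (Sum.inr k) ∈ F

variable {ε}

@[simp]
theorem mem_leftState {F : Finset (Fin c)} {k : Fin a} :
    k ∈ leftState ε F ↔ ε (Sum.inl k) ∈ F := by simp [leftState]

@[simp]
theorem mem_rightState {F : Finset (Fin c)} {k : Fin b} :
    k ∈ rightState ε F ↔ ε (Sum.inr k) ∈ F := by simp [rightState]

theorem leftState_insert_inl (F : Finset (Fin c)) (k : Fin a) :
    leftState ε (insert (ε (Sum.inl k)) F) = insert k (leftState ε F) := by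
  ext l
  simp

theorem rightState_insert_inl (F : Finset (Fin c)) (k : Fin a) :
    rightState ε (insert (ε (Sum.inl k)) F) = rightState ε F := by
  ext l
  simp

theorem leftState_insert_inr (F : Finset (Fin c)) (k : Fin b) :
    leftState ε (insert (ε (Sum.inr k)) F) = leftState ε F := by
  ext l
  simp

theorem rightState_insert_inr (F : Finset (Fin c)) (k : Fin b) :
    rightState ε (insert (ε (Sum.inr k)) F) = insert k (rightState ε F) := by
  ext l
  simp

variable (ε) in
/-- The states of a disjoint union are the pairs of states of the parts. -/
def stateEquiv : Finset (Fin c) ≃ Finset (Fin a) × Finset (Fin b) where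
  toFun F := (leftState ε F, rightState ε F)
  invFun F := (F.1.disjSum F.2).map ε.toEmbedding
  left_inv F := by
    ext k
    obtain ⟨x | x, rfl⟩ := ε.surjective k <;> simp
  right_inv F := by
    ext k <;> simp

theorem card_leftState_add_card_rightState (F : Finset (Fin c)) :
    (leftState ε F).card + (rightState ε F).card = F.card := by
  rw [← Finset.card_disjSum, ← Finset.card_map ε.toEmbedding]
  exact congrArg Finset.card ((stateEquiv ε).symm_apply_apply F)

/-- As a product over all edges, the sign can be compared with `stateSign` and split between the two
parts. -/
theorem edgeSign_eq_prod {m : ℕ} (F : Finset (Fin m)) (e : Fin m) :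
    edgeSign F e = ∏ y, if y ∈ F then 1 else if e < y then -1 else 1 := by
  rw [edgeSign, ← Finset.prod_const, Finset.prod_filter]
  refine Finset.prod_congr rfl fun y _ => ?_
  by_cases h : y ∈ F <;> simp [h]

variable (ε) in
/-- The order of the edges of a disjoint union in which the first part precedes the second. -/
def sumLT (x y : Fin c) : Prop := Sum.Lex (· < ·) (· < ·) (ε.symm x) (ε.symm y)

theorem sumLT_trichotomy {x y : Fin c} (h : x ≠ y) : sumLT ε x y ↔ ¬ sumLT ε y x := by
  obtain ⟨x | x, rfl⟩ := ε.surjective x <;> obtain ⟨y | y, rfl⟩ := ε.surjective y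
  all_goals simp [sumLT] at h ⊢
  all_goals omega

theorem not_sumLT_self (x : Fin c) : ¬ sumLT ε x x := by
  obtain ⟨x | x, rfl⟩ := ε.surjective x <;> simp [sumLT]

open Classical in
variable (ε) in
/-- The sign `-1` for the pairs of edges that are ordered differently in a disjoint union and in
its given enumeration. -/
def inversionSign (x y : Fin c) : ℂ := if x < y ∧ sumLT ε y x then -1 else 1

variable (ε) in
/-- The sign of a state under a change of the enumeration of the edges. -/
def stateSign (F : Finset (Fin c)) : ℂ := ∏ x ∈ Fᶜ, ∏ y ∈ Fᶜ, inversionSign ε x y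

theorem stateSign_mul_self (F : Finset (Fin c)) : stateSign ε F * stateSign ε F = 1 := by
  rw [stateSign, ← Finset.prod_mul_distrib]
  refine Finset.prod_eq_one fun x _ => ?_
  rw [← Finset.prod_mul_distrib]
  refine Finset.prod_eq_one fun y _ => ?_
  rw [inversionSign]
  split_ifs <;> simp

-- `stateSign ε F` and `stateSign ε (insert e F)` differ by one factor for each other missing edge
-- `y`, equal to `-1` exactly when the enumeration and `sumLT` order `e` and `y` differently. These
-- factors replace `<` by `sumLT` in the edge sign.
open Classical in
theorem edgeSign_mul_stateSign {F : Finset (Fin c)} {e : Fin c} (he : e ∉ F) :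
    edgeSign F e * stateSign ε (insert e F) =
      stateSign ε F * ∏ y, if y ∈ F then 1 else if sumLT ε e y then -1 else 1 := by
  have h1 : Fᶜ = insert e (insert e F)ᶜ := by
    ext x
    by_cases hx : x = e <;> simp [hx, he]
  have h2 : e ∉ (insert e F)ᶜ := by simp
  have h3 : ∀ f : Fin c → ℂ, ∏ y, (if y ∈ F then 1 else f y) =
      f e * ∏ y ∈ (insert e F)ᶜ, f y := fun f => by
    rw [← Finset.prod_insert h2, ← h1, ← Finset.prod_filter_mul_prod_filter_not _ (· ∈ F)]
    rw [Finset.prod_eq_one (fun y hy => if_pos (Finset.mem_filter.mp hy).2), one_mul]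
    refine Finset.prod_congr (by ext; simp) fun y hy => if_neg ?_
    simpa using hy
  have h4 : stateSign ε F = (∏ y ∈ (insert e F)ᶜ, inversionSign ε e y * inversionSign ε y e) *
      stateSign ε (insert e F) := by
    have h5 : inversionSign ε e e = 1 := by simp [inversionSign]
    rw [stateSign, h1, Finset.prod_insert h2, Finset.prod_insert h2, h5, one_mul,
      Finset.prod_congr rfl fun x _ => Finset.prod_insert h2, Finset.prod_mul_distrib,
      Finset.prod_mul_distrib, mul_assoc]
    rfl
  rw [edgeSign_eq_prod, h3, h3, if_neg (lt_irrefl e), if_neg (not_sumLT_self e), one_mul, one_mul,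
    h4, mul_right_comm, ← Finset.prod_mul_distrib]
  congr 1
  refine Finset.prod_congr rfl fun y hy => ?_
  have hne : e ≠ y := by
    rintro rfl
    exact h2 hy
  simp only [inversionSign, sumLT_trichotomy hne]
  rcases lt_or_gt_of_ne hne with h | h
  · by_cases h' : sumLT ε y e <;> simp [h, h.not_gt, h']
  · by_cases h' : sumLT ε y e <;> simp [h, h.not_gt, h']

/-- In the order `sumLT` all missing edges of the second part follow `k`. Their number is `b` minus
the size of the right state, which has the parity of the exponent. -/
theorem edgeSign_mul_stateSign_inl {F : Finset (Fin c)} {k : Fin a} (hk : ε (Sum.inl k) ∉ F) :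
    edgeSign F (ε (Sum.inl k)) * stateSign ε (insert (ε (Sum.inl k)) F) =
      stateSign ε F * (edgeSign (leftState ε F) k * (-1) ^ (b + (rightState ε F).card)) := by
  classical
  rw [edgeSign_mul_stateSign hk, ← Equiv.prod_comp ε, Fintype.prod_sum_type, edgeSign_eq_prod]
  congr 2
  · refine Finset.prod_congr rfl fun y _ => ?_
    simp [sumLT]
  · have h1 : ∀ y : Fin b, (if ε (Sum.inr y) ∈ F then (1 : ℂ) else
        if sumLT ε (ε (Sum.inl k)) (ε (Sum.inr y)) then -1 else 1) =
        -1 * if y ∈ rightState ε F then -1 else 1 := fun y => by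
      by_cases hy : ε (Sum.inr y) ∈ F <;> simp [sumLT, hy]
    rw [Finset.prod_congr rfl fun y _ => h1 y, Finset.prod_mul_distrib, Finset.prod_ite_mem]
    simp [pow_add]

theorem edgeSign_mul_stateSign_inr {F : Finset (Fin c)} {k : Fin b} (hk : ε (Sum.inr k) ∉ F) :
    edgeSign F (ε (Sum.inr k)) * stateSign ε (insert (ε (Sum.inr k)) F) =
      stateSign ε F * edgeSign (rightState ε F) k := by
  classical
  rw [edgeSign_mul_stateSign hk, ← Equiv.prod_comp ε, Fintype.prod_sum_type, edgeSign_eq_prod,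
    Finset.prod_eq_one (fun y _ => by simp [sumLT]), one_mul]
  congr 1
  refine Finset.prod_congr rfl fun y _ => ?_
  simp [sumLT]

end States

/-! ### The total complex of a disjoint union -/

section Joint

open TensorProduct

variable {M N : Type*} [AddCommGroup M] [Module ℂ M] [AddCommGroup N] [Module ℂ N]

theorem map_sum_left {ι M' N' : Type*} [AddCommGroup M'] [Module ℂ M'] [AddCommGroup N']
    [Module ℂ N'] (s : Finset ι) (f : ι → M →ₗ[ℂ] M') (g : N →ₗ[ℂ] N') :
    TensorProduct.map (∑ i ∈ s, f i) g = ∑ i ∈ s, TensorProduct.map (f i) g :=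
  map_sum ((TensorProduct.mapBilinear (RingHom.id ℂ) M N M' N').flip g) f s

theorem map_sum_right {ι M' N' : Type*} [AddCommGroup M'] [Module ℂ M'] [AddCommGroup N']
    [Module ℂ N'] (s : Finset ι) (f : M →ₗ[ℂ] M') (g : ι → N →ₗ[ℂ] N') :
    TensorProduct.map f (∑ i ∈ s, g i) = ∑ i ∈ s, TensorProduct.map f (g i) :=
  map_sum (TensorProduct.mapBilinear (RingHom.id ℂ) M N M' N' f) g s

theorem map_sum_smul_add_sum_smul {P Q ι κ : Type*} [AddCommMonoid P] [Module ℂ P]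
    [AddCommMonoid Q] [Module ℂ Q] [Fintype ι] [Fintype κ] (f : P →ₗ[ℂ] Q)
    (s : ι → ℂ) (x : ι → P) (t : κ → ℂ) (y : κ → P) :
    f (∑ i, s i • x i + ∑ i, t i • y i) = ∑ i, s i • f (x i) + ∑ i, t i • f (y i) := by
  simp only [map_add, map_sum, map_smul]

/-- Jointly injective families of linear maps have jointly injective tensor products. -/
theorem tensor_eq_zero_of_forall_map_eq_zero {ι κ : Type*} [Fintype ι] [Fintype κ]
    {M' : ι → Type*} {N' : κ → Type*} [∀ i, AddCommGroup (M' i)] [∀ i, Module ℂ (M' i)]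
    [∀ i, AddCommGroup (N' i)] [∀ i, Module ℂ (N' i)] {u : ∀ i, M →ₗ[ℂ] M' i}
    {v : ∀ i, N →ₗ[ℂ] N' i} (hu : ∀ x, (∀ i, u i x = 0) → x = 0)
    (hv : ∀ y, (∀ i, v i y = 0) → y = 0) {z : M ⊗[ℂ] N}
    (hz : ∀ i k, TensorProduct.map (u i) (v k) z = 0) : z = 0 := by
  classical
  have hu' : Function.Injective (LinearMap.pi u) :=
    (injective_iff_map_eq_zero _).mpr fun x hx => hu x fun i => congrFun hx i
  have hv' : Function.Injective (LinearMap.pi v) :=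
    (injective_iff_map_eq_zero _).mpr fun x hx => hv x fun i => congrFun hx i
  -- Over a field all modules are flat, so the tensor product of the two injections into products is
  -- injective.
  have h := TensorProduct.map_injective_of_flat_flat (LinearMap.pi u) (LinearMap.pi v) hu' hv'
  apply h
  rw [map_zero]
  have h1 : LinearMap.pi u = ∑ i, LinearMap.single ℂ M' i ∘ₗ u i := by
    refine LinearMap.ext fun x => ?_
    rw [LinearMap.sum_apply]
    exact (Finset.univ_sum_single fun i => u i x).symm
  have h2 : LinearMap.pi v = ∑ i, LinearMap.single ℂ N' i ∘ₗ v i := by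
    refine LinearMap.ext fun x => ?_
    rw [LinearMap.sum_apply]
    exact (Finset.univ_sum_single fun i => v i x).symm
  rw [h1, h2, map_sum_left, LinearMap.sum_apply]
  refine Finset.sum_eq_zero fun i _ => ?_
  rw [map_sum_right, LinearMap.sum_apply]
  refine Finset.sum_eq_zero fun k _ => ?_
  rw [TensorProduct.map_comp, LinearMap.comp_apply, hz, map_zero]

theorem map_tensorGrading {M' N' : Type*} [AddCommGroup M'] [Module ℂ M'] [AddCommGroup N']
    [Module ℂ N'] {e : (ℕ → ℂ) → Module.End ℂ M} {e' : (ℕ → ℂ) → Module.End ℂ N}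
    {u : M →ₗ[ℂ] M'} {v : N →ₗ[ℂ] N'} {m n K : ℕ} (hu : ∀ w, u ∘ₗ e w = w m • u)
    (hv : ∀ w, v ∘ₗ e' w = w n • v) (hn : n < K) (w : ℕ → ℂ) (z : M ⊗[ℂ] N) :
    TensorProduct.map u v (tensorGrading e e' K w z) = w (m + n) • TensorProduct.map u v z := by
  rw [tensorGrading, LinearMap.sum_apply, map_sum, Finset.sum_eq_single n]
  · rw [← LinearMap.comp_apply, ← TensorProduct.map_comp, hu, hv, Pi.single_eq_same, one_smul,
      TensorProduct.map_smul_left, LinearMap.smul_apply]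
  · intro k _ hk
    rw [← LinearMap.comp_apply, ← TensorProduct.map_comp, hv, Pi.single_eq_of_ne hk.symm,
      zero_smul, TensorProduct.map_zero_right, LinearMap.zero_apply]
  · intro h
    exact absurd (Finset.mem_range.mpr hn) h

theorem map_tensorDiff {M' N' ι κ : Type*} [AddCommGroup M'] [Module ℂ M'] [AddCommGroup N']
    [Module ℂ N'] [Fintype ι] [Fintype κ] {D : Module.End ℂ M} {D' E : Module.End ℂ N}
    {u : M →ₗ[ℂ] M'} {v : N →ₗ[ℂ] N'} {f : ι → M →ₗ[ℂ] M'} {g : κ → N →ₗ[ℂ] N'} {t : ℂ}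
    (hu : u ∘ₗ D = ∑ i, f i) (hv : v ∘ₗ D' = ∑ i, g i) (hE : v ∘ₗ E = t • v) (z : M ⊗[ℂ] N) :
    TensorProduct.map u v ((TensorProduct.map D E + TensorProduct.map 1 D' :
      Module.End ℂ (M ⊗[ℂ] N)) z) =
      ∑ i, t • TensorProduct.map (f i) v z + ∑ i, TensorProduct.map u (g i) z := by
  rw [LinearMap.add_apply, map_add, ← LinearMap.comp_apply, ← LinearMap.comp_apply,
    ← TensorProduct.map_comp, ← TensorProduct.map_comp, hu, hv, hE, map_sum_left, map_sum_right,
    LinearMap.sum_apply, LinearMap.sum_apply]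
  congr 1
  refine Finset.sum_congr rfl fun i _ => ?_
  rw [TensorProduct.map_smul_right, LinearMap.smul_apply]

end Joint

section Product

open TensorProduct

variable {α₁ β₁ α₂ β₂ : Type*} (G₁ : Graph α₁ β₁) (G₂ : Graph α₂ β₂)
  [Fintype V(G₁)] [Fintype V(G₂)] {a b : ℕ} (ω₁ : Fin a ≃ E(G₁)) (ω₂ : Fin b ≃ E(G₂)) (j : ℕ)

/-- The part of exterior degree `j` of the tensor product of the total complexes of two graphs. -/
abbrev ProductTotal : Type _ :=
  (p : Bidegree j) → Total G₁ ω₁ p.1.1 ⊗[ℂ] Total G₂ ω₂ p.1.2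

/-- The action of the two symmetric groups on the tensor product of the total complexes. -/
def productRep : Representation ℂ (Equiv.Perm V(G₁) × Equiv.Perm V(G₂))
    (ProductTotal G₁ G₂ ω₁ ω₂ j) where
  toFun g := piEnd fun p =>
    TensorProduct.map (totalRep G₁ ω₁ p.1.1 g.1) (totalRep G₂ ω₂ p.1.2 g.2)
  map_one' := by
    rw [← map_one piEnd]
    congr 1
    funext p
    rw [Prod.fst_one, Prod.snd_one, map_one, map_one, TensorProduct.map_one]
    rfl
  map_mul' g g' := by
    rw [← map_mul piEnd]
    congr 1
    funext p
    rw [Prod.fst_mul, Prod.snd_mul, map_mul, map_mul, TensorProduct.map_mul]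
    rfl

/-- The differential of the tensor product of the total complexes. -/
def productDiff : Module.End ℂ (ProductTotal G₁ G₂ ω₁ ω₂ j) := piEnd fun p =>
  TensorProduct.map (totalDiff G₁ ω₁ p.1.1) (totalGrading G₂ ω₂ p.1.2 fun i => (-1) ^ (b + i)) +
    TensorProduct.map 1 (totalDiff G₂ ω₂ p.1.2)

/-- The grading of the tensor product of the total complexes. -/
def productGrading (w : ℕ → ℂ) : Module.End ℂ (ProductTotal G₁ G₂ ω₁ ω₂ j) := piEnd fun p =>
  tensorGrading (totalGrading G₁ ω₁ p.1.1) (totalGrading G₂ ω₂ p.1.2) (b + 1) w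

/-- The value of a chain at a state and at the identity permutation. -/
def stateValue {α β : Type*} (G : Graph α β) [Fintype V(G)] {m : ℕ} (ω : Fin m ≃ E(G)) (j : ℕ)
    (F : Finset (Fin m)) : Total G ω j →ₗ[ℂ] ⋀[ℂ]^j (SumZero (components G ω F)) :=
  BlockModule.eval 1 ∘ₗ LinearMap.proj F

/-- The value of a chain at a state, projected to a finer state. -/
def splitValue {α β : Type*} (G : Graph α β) [Fintype V(G)] {m : ℕ} (ω : Fin m ≃ E(G)) (j : ℕ)
    (F F' : Finset (Fin m)) : Total G ω j →ₗ[ℂ] ⋀[ℂ]^j (SumZero (components G ω F)) :=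
  exteriorPower.map j (split (components G ω F') (components G ω F)) ∘ₗ stateValue G ω j F'

theorem splitValue_self {α β : Type*} (G : Graph α β) [Fintype V(G)] {m : ℕ} (ω : Fin m ≃ E(G))
    (j : ℕ) (F : Finset (Fin m)) : splitValue G ω j F F = stateValue G ω j F := by
  rw [splitValue, split_self, exteriorPower.map_id, LinearMap.id_comp]

theorem stateValue_comp_totalDiff {α β : Type*} (G : Graph α β) [Fintype V(G)] {m : ℕ}
    (ω : Fin m ≃ E(G)) (j : ℕ) (F : Finset (Fin m)) :
    stateValue G ω j F ∘ₗ totalDiff G ω j = ∑ e,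
      if e ∈ F then 0 else edgeSign F e • splitValue G ω j F (insert e F) := by
  refine LinearMap.ext fun c => (eval_totalDiff G ω j c F 1).trans ?_
  rw [LinearMap.sum_apply]
  refine Finset.sum_congr rfl fun e _ => ?_
  split_ifs <;> rfl

theorem stateValue_comp_totalGrading {α β : Type*} (G : Graph α β) [Fintype V(G)] {m : ℕ}
    (ω : Fin m ≃ E(G)) (j : ℕ) (F : Finset (Fin m)) (w : ℕ → ℂ) :
    stateValue G ω j F ∘ₗ totalGrading G ω j w = w F.card • stateValue G ω j F := by
  refine LinearMap.ext fun c => ?_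
  exact map_smul (BlockModule.eval 1) (w F.card) (c F)

theorem stateValue_comp_totalRep {α β : Type*} (G : Graph α β) [Fintype V(G)] {m : ℕ}
    (ω : Fin m ≃ E(G)) (j : ℕ) (F : Finset (Fin m)) (g : youngSubgroup (components G ω F)) :
    stateValue G ω j F ∘ₗ totalRep G ω j g =
      exteriorPower.map j (sumZeroRep _ g) ∘ₗ stateValue G ω j F := by
  refine LinearMap.ext fun c => ?_
  change BlockModule.eval (1 * g.1) (c F) = exteriorPower.map j _ (BlockModule.eval 1 (c F))
  rw [← BlockModule.eval_mul, one_mul, mul_one]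

/-- The value at `σ` is the value at the identity after acting by `σ`, so these functionals see
every value of the chain. -/
theorem eq_zero_of_stateValue_eq_zero {α β : Type*} (G : Graph α β) [Fintype V(G)] {m : ℕ}
    (ω : Fin m ≃ E(G)) (j : ℕ) (c : Total G ω j) (hc : ∀ q : Finset (Fin m) × Equiv.Perm V(G),
      (stateValue G ω j q.1 ∘ₗ totalRep G ω j q.2) c = 0) : c = 0 := by
  funext F
  refine BlockModule.ext_eval fun σ => ?_
  have h : BlockModule.eval (1 * σ) (c F) = 0 := hc (F, σ)
  rwa [one_mul] at h

end Product

/-! ### The Künneth map and its compatibility with the differentials -/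

section Kunneth

open TensorProduct

variable {α₁ β₁ α₂ β₂ α β : Type*} {G₁ : Graph α₁ β₁} {G₂ : Graph α₂ β₂} {G : Graph α β}
  [Fintype V(G₁)] [Fintype V(G₂)] [Fintype V(G)] {a b c : ℕ} {ω₁ : Fin a ≃ E(G₁)}
  {ω₂ : Fin b ≃ E(G₂)} {ω : Fin c ≃ E(G)} {e : V(G₁) ⊕ V(G₂) ≃ V(G)}
  {ε : Fin a ⊕ Fin b ≃ Fin c}
  (hsum : ∀ F, IsSum e (components G ω F) (components G₁ ω₁ (leftState ε F))
    (components G₂ ω₂ (rightState ε F))) (j : ℕ)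

/-- The product of values of chains of two graphs, as a value for the disjoint union. -/
def stateWedge (F : Finset (Fin c)) :
    ((p : Bidegree j) → (⋀[ℂ]^p.1.1 (SumZero (components G₁ ω₁ (leftState ε F)))) ⊗[ℂ]
      (⋀[ℂ]^p.1.2 (SumZero (components G₂ ω₂ (rightState ε F))))) →ₗ[ℂ]
      ⋀[ℂ]^j (SumZero (components G ω F)) :=
  wedge (hsum F).incl (hsum F).symm.incl j

/-- The value of the product of chains of two graphs at a state of the disjoint union. -/
def glue (F : Finset (Fin c)) :
    ProductTotal G₁ G₂ ω₁ ω₂ j →ₗ[ℂ] ⋀[ℂ]^j (SumZero (components G ω F)) :=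
  stateWedge hsum j F ∘ₗ LinearMap.pi fun p =>
    TensorProduct.map (stateValue G₁ ω₁ p.1.1 (leftState ε F))
      (stateValue G₂ ω₂ p.1.2 (rightState ε F)) ∘ₗ LinearMap.proj p

theorem glue_apply (F : Finset (Fin c)) (z : ProductTotal G₁ G₂ ω₁ ω₂ j) :
    glue hsum j F z = stateWedge hsum j F fun p =>
      TensorProduct.map (stateValue G₁ ω₁ p.1.1 (leftState ε F))
        (stateValue G₂ ω₂ p.1.2 (rightState ε F)) (z p) := rfl

theorem glue_productRep (F : Finset (Fin c)) (z : ProductTotal G₁ G₂ ω₁ ω₂ j)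
    (g : Equiv.Perm V(G₁) × Equiv.Perm V(G₂)) (g' : youngSubgroup (components G ω F))
    (hg : g'.1 = sumPerm e g) : glue hsum j F (productRep G₁ G₂ ω₁ ω₂ j g z) =
      exteriorPower.map j (sumZeroRep _ g') (glue hsum j F z) := by
  have hmem := ((hsum F).sumPerm_mem g).mp (hg ▸ g'.2)
  have hL := (hsum F).rep_comp_incl g ⟨g.1, hmem.1⟩ rfl g' hg
  have hR := (hsum F).symm.rep_comp_incl g.swap ⟨g.2, hmem.2⟩ rfl g'
    (hg.trans (sumPerm_swap e g).symm)
  rw [glue_apply, glue_apply, stateWedge, map_wedge hL hR]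
  congr 1
  funext p
  have h1 := stateValue_comp_totalRep G₁ ω₁ p.1.1 (leftState ε F) ⟨g.1, hmem.1⟩
  have h2 := stateValue_comp_totalRep G₂ ω₂ p.1.2 (rightState ε F) ⟨g.2, hmem.2⟩
  rw [← LinearMap.comp_apply, ← TensorProduct.map_comp, ← h1, ← h2, TensorProduct.map_comp]
  rfl

theorem split_glue (F F' : Finset (Fin c)) (z : ProductTotal G₁ G₂ ω₁ ω₂ j) :
    exteriorPower.map j (split (components G ω F') (components G ω F)) (glue hsum j F' z) =
      stateWedge hsum j F fun p =>
        TensorProduct.map (splitValue G₁ ω₁ p.1.1 (leftState ε F) (leftState ε F'))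
          (splitValue G₂ ω₂ p.1.2 (rightState ε F) (rightState ε F')) (z p) := by
  rw [glue_apply, stateWedge, stateWedge,
    map_wedge ((hsum F').split_comp_incl (hsum F)) ((hsum F').symm.split_comp_incl (hsum F).symm)]
  congr 1
  funext p
  rw [← LinearMap.comp_apply, ← TensorProduct.map_comp]
  rfl

/-- The product of a family of chains of two graphs, as a chain of their disjoint union. -/
def kunneth : Representation.coindV (sumPerm e) (productRep G₁ G₂ ω₁ ω₂ j) →ₗ[ℂ]
    Total G ω j where
  toFun φ F := ⟨fun σ => stateSign ε F • glue hsum j F (φ.1 σ), fun g σ => by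
    obtain ⟨g', hg'⟩ := (hsum F).exists_sumPerm_eq g.2
    change stateSign ε F • glue hsum j F (φ.1 (g.1 * σ)) =
      exteriorPower.map j (sumZeroRep _ g) (stateSign ε F • glue hsum j F (φ.1 σ))
    rw [← hg', φ.2 g' σ, glue_productRep hsum j F _ g' g hg'.symm, map_smul]⟩
  map_add' φ ψ := by
    funext F
    refine Subtype.ext <| funext fun σ => ?_
    change stateSign ε F • glue hsum j F (φ.1 σ + ψ.1 σ) =
      stateSign ε F • glue hsum j F (φ.1 σ) + stateSign ε F • glue hsum j F (ψ.1 σ)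
    rw [map_add, smul_add]
  map_smul' z φ := by
    funext F
    refine Subtype.ext <| funext fun σ => ?_
    change stateSign ε F • glue hsum j F (z • φ.1 σ) = z • stateSign ε F • glue hsum j F (φ.1 σ)
    rw [map_smul, smul_comm]

theorem eval_kunneth (φ : Representation.coindV (sumPerm e) (productRep G₁ G₂ ω₁ ω₂ j))
    (F : Finset (Fin c)) (σ : Equiv.Perm V(G)) :
    BlockModule.eval σ (kunneth hsum j φ F) = stateSign ε F • glue hsum j F (φ.1 σ) := rfl

/-- If `φ` is killed, injectivity of `wedge` at each state shows that all tensor products of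
evaluations vanish on every component of `φ σ`. Such evaluations are jointly injective. -/
theorem kunneth_injective : Function.Injective (kunneth hsum j) := by
  classical
  rw [injective_iff_map_eq_zero]
  intro φ hφ
  have h1 : ∀ F σ, glue hsum j F (φ.1 σ) = 0 := fun F σ => by
    have h2 := eval_kunneth hsum j φ F σ
    rw [hφ, Pi.zero_apply, map_zero] at h2
    rw [← one_smul ℂ (glue hsum j F (φ.1 σ)), ← stateSign_mul_self (ε := ε) F, mul_smul, ← h2,
      smul_zero]
  refine Subtype.ext <| funext fun σ => funext fun p => ?_
  refine tensor_eq_zero_of_forall_map_eq_zero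
    (eq_zero_of_stateValue_eq_zero G₁ ω₁ p.1.1) (eq_zero_of_stateValue_eq_zero G₂ ω₂ p.1.2) ?_
  rintro ⟨F₁, g₁⟩ ⟨F₂, g₂⟩
  obtain ⟨F, hF⟩ := (stateEquiv ε).surjective (F₁, F₂)
  obtain ⟨rfl, rfl⟩ : leftState ε F = F₁ ∧ rightState ε F = F₂ := Prod.mk.inj hF
  -- `glue` evaluates only at the identity; equivariance of `φ` turns translation by a block
  -- permutation into evaluation at `(g₁, g₂)`.
  have h3 := h1 F (sumPerm e (g₁, g₂) * σ)
  rw [φ.2 (g₁, g₂) σ, glue_apply] at h3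
  have h4 := wedge_injective (hsum F).range_sup_range (hsum F).finrank_sumZero j
    (h3.trans (map_zero (wedge (hsum F).incl (hsum F).symm.incl j)).symm)
  have h5 := congrFun h4 p
  rw [TensorProduct.map_comp]
  exact h5

theorem glue_productGrading (w : ℕ → ℂ) (F : Finset (Fin c)) (z : ProductTotal G₁ G₂ ω₁ ω₂ j) :
    glue hsum j F (productGrading G₁ G₂ ω₁ ω₂ j w z) = w F.card • glue hsum j F z := by
  rw [glue_apply, glue_apply, ← map_smul]
  congr 1
  funext p
  have h := map_tensorGrading (stateValue_comp_totalGrading G₁ ω₁ p.1.1 (leftState ε F))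
    (stateValue_comp_totalGrading G₂ ω₂ p.1.2 (rightState ε F))
    (Nat.lt_succ_of_le (card_finset_fin_le (rightState ε F))) w (z p)
  rw [card_leftState_add_card_rightState] at h
  exact h

theorem map_stateValue_productDiff (F₁ : Finset (Fin a)) (F₂ : Finset (Fin b)) (i₁ i₂ : ℕ)
    (z : Total G₁ ω₁ i₁ ⊗[ℂ] Total G₂ ω₂ i₂) :
    TensorProduct.map (stateValue G₁ ω₁ i₁ F₁) (stateValue G₂ ω₂ i₂ F₂)
      ((TensorProduct.map (totalDiff G₁ ω₁ i₁) (totalGrading G₂ ω₂ i₂ fun i => (-1) ^ (b + i)) +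
        TensorProduct.map 1 (totalDiff G₂ ω₂ i₂) :
          Module.End ℂ (Total G₁ ω₁ i₁ ⊗[ℂ] Total G₂ ω₂ i₂)) z) =
      (∑ k : Fin a, if k ∈ F₁ then 0 else (edgeSign F₁ k * (-1) ^ (b + F₂.card)) •
        TensorProduct.map (splitValue G₁ ω₁ i₁ F₁ (insert k F₁)) (splitValue G₂ ω₂ i₂ F₂ F₂) z) +
      ∑ k : Fin b, if k ∈ F₂ then 0 else edgeSign F₂ k •
        TensorProduct.map (splitValue G₁ ω₁ i₁ F₁ F₁) (splitValue G₂ ω₂ i₂ F₂ (insert k F₂)) z := by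
  refine (map_tensorDiff (stateValue_comp_totalDiff G₁ ω₁ i₁ F₁)
    (stateValue_comp_totalDiff G₂ ω₂ i₂ F₂)
    (stateValue_comp_totalGrading G₂ ω₂ i₂ F₂ _) z).trans ?_
  rw [splitValue_self, splitValue_self]
  congr 1
  · refine Finset.sum_congr rfl fun k _ => ?_
    split_ifs
    · rw [TensorProduct.map_zero_left, LinearMap.zero_apply, smul_zero]
    · rw [TensorProduct.map_smul_left, LinearMap.smul_apply, smul_smul, mul_comm]
  · refine Finset.sum_congr rfl fun k _ => ?_
    split_ifs
    · rw [TensorProduct.map_zero_right, LinearMap.zero_apply]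
    · rw [TensorProduct.map_smul_right, LinearMap.smul_apply]

/-- The pairs of projected values of a product of chains of two graphs. -/
def splitPair (F₁ F₁' : Finset (Fin a)) (F₂ F₂' : Finset (Fin b))
    (z : ProductTotal G₁ G₂ ω₁ ω₂ j) (p : Bidegree j) :
    (⋀[ℂ]^p.1.1 (SumZero (components G₁ ω₁ F₁))) ⊗[ℂ]
      (⋀[ℂ]^p.1.2 (SumZero (components G₂ ω₂ F₂))) :=
  TensorProduct.map (splitValue G₁ ω₁ p.1.1 F₁ F₁') (splitValue G₂ ω₂ p.1.2 F₂ F₂') (z p)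

theorem map_stateValue_productDiff_eq_sum (F₁ : Finset (Fin a)) (F₂ : Finset (Fin b))
    (z : ProductTotal G₁ G₂ ω₁ ω₂ j) :
    (fun p => TensorProduct.map (stateValue G₁ ω₁ p.1.1 F₁) (stateValue G₂ ω₂ p.1.2 F₂)
        (productDiff G₁ G₂ ω₁ ω₂ j z p)) =
      (∑ k : Fin a, (if k ∈ F₁ then 0 else edgeSign F₁ k * (-1) ^ (b + F₂.card)) •
        splitPair j F₁ (insert k F₁) F₂ F₂ z) +
      ∑ k : Fin b, (if k ∈ F₂ then 0 else edgeSign F₂ k) •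
        splitPair j F₁ F₁ F₂ (insert k F₂) z := by
  funext p
  refine (map_stateValue_productDiff F₁ F₂ p.1.1 p.1.2 (z p)).trans ?_
  rw [Pi.add_apply, Finset.sum_apply, Finset.sum_apply]
  refine congrArg₂ _ (Finset.sum_congr rfl fun k _ => ?_) (Finset.sum_congr rfl fun k _ => ?_)
  · rw [Pi.smul_apply]
    split_ifs
    · rw [zero_smul]
    · rfl
  · rw [Pi.smul_apply]
    split_ifs
    · rw [zero_smul]
    · rfl

theorem split_glue_eq_splitPair (F F' : Finset (Fin c)) (z : ProductTotal G₁ G₂ ω₁ ω₂ j)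
    {F₁ : Finset (Fin a)} {F₂ : Finset (Fin b)} (h₁ : leftState ε F' = F₁)
    (h₂ : rightState ε F' = F₂) :
    exteriorPower.map j (split (components G ω F') (components G ω F)) (glue hsum j F' z) =
      stateWedge hsum j F (splitPair j (leftState ε F) F₁ (rightState ε F) F₂ z) := by
  subst h₁ h₂
  exact split_glue hsum j F F' z

theorem glue_productDiff (F : Finset (Fin c)) (z : ProductTotal G₁ G₂ ω₁ ω₂ j) :
    glue hsum j F (productDiff G₁ G₂ ω₁ ω₂ j z) =
      (∑ k : Fin a, (if k ∈ leftState ε F then 0 else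
        edgeSign (leftState ε F) k * (-1) ^ (b + (rightState ε F).card)) •
        exteriorPower.map j (split (components G ω (insert (ε (Sum.inl k)) F)) (components G ω F))
          (glue hsum j (insert (ε (Sum.inl k)) F) z)) +
      ∑ k : Fin b, (if k ∈ rightState ε F then 0 else edgeSign (rightState ε F) k) •
        exteriorPower.map j (split (components G ω (insert (ε (Sum.inr k)) F)) (components G ω F))
          (glue hsum j (insert (ε (Sum.inr k)) F) z) := by
  rw [glue_apply, map_stateValue_productDiff_eq_sum]
  refine (map_sum_smul_add_sum_smul (stateWedge hsum j F) _ _ _ _).trans ?_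
  refine congrArg₂ _ (Finset.sum_congr rfl fun k _ => ?_) (Finset.sum_congr rfl fun k _ => ?_)
  · exact congrArg _ (split_glue_eq_splitPair hsum j F _ z (leftState_insert_inl F k)
      (rightState_insert_inl F k)).symm
  · exact congrArg _ (split_glue_eq_splitPair hsum j F _ z (leftState_insert_inr F k)
      (rightState_insert_inr F k)).symm

/-- This is the chain map property: the edges are split along `ε`, and `stateSign` converts each
edge sign into that of the tensor product differential. -/
theorem eval_totalDiff_kunneth
    (φ : Representation.coindV (sumPerm e) (productRep G₁ G₂ ω₁ ω₂ j)) (F : Finset (Fin c))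
    (σ : Equiv.Perm V(G)) : BlockModule.eval σ (totalDiff G ω j (kunneth hsum j φ) F) =
      stateSign ε F • glue hsum j F (productDiff G₁ G₂ ω₁ ω₂ j (φ.1 σ)) := by
  rw [eval_totalDiff, ← Equiv.sum_comp ε, Fintype.sum_sum_type, glue_productDiff, smul_add,
    Finset.smul_sum, Finset.smul_sum]
  refine congrArg₂ _ (Finset.sum_congr rfl fun k _ => ?_) (Finset.sum_congr rfl fun k _ => ?_)
  · simp only [mem_leftState]
    split_ifs with hk
    · rw [zero_smul, smul_zero]
    · rw [eval_kunneth, map_smul, smul_smul, smul_smul, edgeSign_mul_stateSign_inl hk]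
  · simp only [mem_rightState]
    split_ifs with hk
    · rw [zero_smul, smul_zero]
    · rw [eval_kunneth, map_smul, smul_smul, smul_smul, edgeSign_mul_stateSign_inr hk]

end Kunneth

/-! ### Cycle types of block permutations -/

section PowerSum

variable {V V₁ V₂ : Type*}

theorem sumPerm_eq_mul_extendDomain (e : V₁ ⊕ V₂ ≃ V) (g : Equiv.Perm V₁ × Equiv.Perm V₂)
    [DecidablePred (· ∈ Set.range (e ∘ Sum.inl))] [DecidablePred (· ∈ Set.range (e ∘ Sum.inr))] :
    sumPerm e g =
      g.1.extendDomain (Equiv.ofInjective (e ∘ Sum.inl) (e.injective.comp Sum.inl_injective)) *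
      g.2.extendDomain (Equiv.ofInjective (e ∘ Sum.inr) (e.injective.comp Sum.inr_injective)) ∧
    Equiv.Perm.Disjoint
      (g.1.extendDomain (Equiv.ofInjective (e ∘ Sum.inl) (e.injective.comp Sum.inl_injective)))
      (g.2.extendDomain (Equiv.ofInjective (e ∘ Sum.inr) (e.injective.comp Sum.inr_injective))) :=
    by
  have h1 := Equiv.Perm.extendDomain_apply_image g.1
    (Equiv.ofInjective (e ∘ Sum.inl) (e.injective.comp Sum.inl_injective))
  have h2 := Equiv.Perm.extendDomain_apply_image g.2
    (Equiv.ofInjective (e ∘ Sum.inr) (e.injective.comp Sum.inr_injective))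
  have h3 : ∀ x, g.1.extendDomain
      (Equiv.ofInjective (e ∘ Sum.inl) (e.injective.comp Sum.inl_injective)) (e (Sum.inr x)) =
      e (Sum.inr x) := fun x => Equiv.Perm.extendDomain_apply_not_subtype _ _ (by simp)
  have h4 : ∀ x, g.2.extendDomain
      (Equiv.ofInjective (e ∘ Sum.inr) (e.injective.comp Sum.inr_injective)) (e (Sum.inl x)) =
      e (Sum.inl x) := fun x => Equiv.Perm.extendDomain_apply_not_subtype _ _ (by simp)
  simp only [Equiv.ofInjective_apply, Function.comp_apply] at h1 h2
  constructor
  · ext v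
    obtain ⟨x | y, rfl⟩ := e.surjective v
    · rw [sumPerm_inl, Equiv.Perm.mul_apply, h4, h1]
    · rw [sumPerm_inr, Equiv.Perm.mul_apply, h2, h3]
  · intro v
    obtain ⟨x | y, rfl⟩ := e.surjective v
    · exact Or.inr (h4 x)
    · exact Or.inl (h3 y)

variable [Fintype V] [DecidableEq V]

/-- The power sum symmetric function of the cycle type of a permutation. -/
def cyclePowerSum (σ : Equiv.Perm V) : SymFun := (σ.partition.parts.map powerSum).prod

theorem cyclePowerSum_conj (σ τ : Equiv.Perm V) :
    cyclePowerSum (τ * σ * τ⁻¹) = cyclePowerSum σ := by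
  unfold cyclePowerSum
  rw [Equiv.Perm.partition_eq_of_isConj.mp (isConj_iff.mpr ⟨τ, rfl⟩ : IsConj σ (τ * σ * τ⁻¹))]

variable [Fintype V₁] [DecidableEq V₁] [Fintype V₂] [DecidableEq V₂]

/-- A block permutation is a product of two disjoint permutations, so cycle types add. `cycleType`
omits fixed points, so the parts equal to `1` are counted separately. -/
theorem parts_partition_sumPerm (e : V₁ ⊕ V₂ ≃ V) (g : Equiv.Perm V₁ × Equiv.Perm V₂) :
    (sumPerm e g).partition.parts = g.1.partition.parts + g.2.partition.parts := by
  classical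
  obtain ⟨h1, h2⟩ := sumPerm_eq_mul_extendDomain e g
  have h3 : (sumPerm e g).cycleType = g.1.cycleType + g.2.cycleType := by
    rw [h1, h2.cycleType_mul, Equiv.Perm.cycleType_extendDomain, Equiv.Perm.cycleType_extendDomain]
  have h4 := congrArg Multiset.sum h3
  rw [Multiset.sum_add, Equiv.Perm.sum_cycleType, Equiv.Perm.sum_cycleType,
    Equiv.Perm.sum_cycleType] at h4
  have h5 : Fintype.card V = Fintype.card V₁ + Fintype.card V₂ := by
    rw [← Fintype.card_sum, Fintype.card_congr e]
  have h6 := g.1.support.card_le_univ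
  have h7 := g.2.support.card_le_univ
  rw [Equiv.Perm.parts_partition, Equiv.Perm.parts_partition, Equiv.Perm.parts_partition, h3, h4,
    h5, show Fintype.card V₁ + Fintype.card V₂ - (g.1.support.card + g.2.support.card) =
      (Fintype.card V₁ - g.1.support.card) + (Fintype.card V₂ - g.2.support.card) by omega,
    Multiset.replicate_add]
  abel

theorem cyclePowerSum_sumPerm (e : V₁ ⊕ V₂ ≃ V) (g : Equiv.Perm V₁ × Equiv.Perm V₂) :
    cyclePowerSum (sumPerm e g) = cyclePowerSum g.1 * cyclePowerSum g.2 := by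
  rw [cyclePowerSum, parts_partition_sumPerm, Multiset.map_add, Multiset.prod_add]
  rfl

theorem frobeniusChar_eq {M : Type*} [AddCommGroup M] [Module ℂ M]
    (ρ : Representation ℂ (Equiv.Perm V) M) : frobeniusChar ρ =
      (Fintype.card (Equiv.Perm V) : ℂ)⁻¹ • ∑ σ, ρ.character σ • cyclePowerSum σ := by
  rw [Fintype.card_perm]
  rfl

end PowerSum

/-! ### Dimension count for the Künneth map -/

section Kunneth

open TensorProduct

variable {α₁ β₁ α₂ β₂ α β : Type*} {G₁ : Graph α₁ β₁} {G₂ : Graph α₂ β₂} {G : Graph α β}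
  [Fintype V(G₁)] [Fintype V(G₂)] [Fintype V(G)] {a b c : ℕ} {ω₁ : Fin a ≃ E(G₁)}
  {ω₂ : Fin b ≃ E(G₂)} {ω : Fin c ≃ E(G)} {e : V(G₁) ⊕ V(G₂) ≃ V(G)}
  {ε : Fin a ⊕ Fin b ≃ Fin c}
  (hsum : ∀ F, IsSum e (components G ω F) (components G₁ ω₁ (leftState ε F))
    (components G₂ ω₂ (rightState ε F))) (j : ℕ)

theorem finrank_total (G : Graph α β) [Fintype V(G)] (ω : Fin c ≃ E(G)) :
    (Module.finrank ℂ (Total G ω j) : ℂ) = ∑ F, (Nat.card (Equiv.Perm V(G)) : ℂ) *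
      Module.finrank ℂ (⋀[ℂ]^j (SumZero (components G ω F))) /
        Nat.card (youngSubgroup (components G ω F)) := by
  classical
  rw [Module.finrank_pi_fintype, Nat.cast_sum]
  refine Finset.sum_congr rfl fun F _ => ?_
  rw [eq_div_iff (by exact_mod_cast Nat.card_pos.ne'), mul_comm]
  exact finrank_blockModule _ j

/-- Pairs of states are reindexed by states of the union. At each of these, orders of Young
subgroups multiply and dimensions of exterior powers convolve. -/
theorem finrank_productTotal
    (hsum : ∀ F, IsSum e (components G ω F) (components G₁ ω₁ (leftState ε F))
      (components G₂ ω₂ (rightState ε F))) (j : ℕ) :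
    (Module.finrank ℂ (ProductTotal G₁ G₂ ω₁ ω₂ j) : ℂ) =
      ∑ F, (Nat.card (Equiv.Perm V(G₁)) * Nat.card (Equiv.Perm V(G₂)) : ℂ) *
      Module.finrank ℂ (⋀[ℂ]^j (SumZero (components G ω F))) /
        Nat.card (youngSubgroup (components G ω F)) := by
  have h2 : ∀ x f u y g v : ℂ, x * f / u * (y * g / v) = x * y * (f * g) / (u * v) := by
    intros
    ring
  rw [Module.finrank_pi_fintype, Nat.cast_sum]
  simp only [Module.finrank_tensorProduct, Nat.cast_mul, finrank_total, Finset.sum_mul_sum]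
  rw [Finset.sum_congr rfl fun p _ => (Fintype.sum_prod_type' _).symm,
    Finset.sum_congr rfl fun p _ => ((stateEquiv ε).sum_comp _).symm, Finset.sum_comm]
  refine Finset.sum_congr rfl fun F _ => ?_
  rw [finrank_exteriorPower_eq_sum (hsum F).finrank_sumZero, Nat.cast_sum, Finset.mul_sum,
    Finset.sum_div, (hsum F).card_youngSubgroup]
  refine Finset.sum_congr rfl fun p _ => ?_
  rw [Nat.cast_mul, Nat.cast_mul]
  exact h2 _ _ _ _ _ _

theorem kunneth_bijective : Function.Bijective (kunneth hsum j) := by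
  classical
  have hdim : Module.finrank ℂ (Representation.coindV (sumPerm e) (productRep G₁ G₂ ω₁ ω₂ j)) =
      Module.finrank ℂ (Total G ω j) := by
    have h1 := finrank_coindV (sumPerm e) (productRep G₁ G₂ ω₁ ω₂ j) (sumPerm_injective e)
    rw [finrank_productTotal hsum j, Fintype.card_prod, Nat.cast_mul] at h1
    simp only [Fintype.card_eq_nat_card] at h1
    have h2 : (Nat.card (Equiv.Perm V(G₁)) * Nat.card (Equiv.Perm V(G₂)) : ℂ) ≠ 0 :=
      mul_ne_zero (by exact_mod_cast Nat.card_pos.ne') (by exact_mod_cast Nat.card_pos.ne')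
    have h3 : (Module.finrank ℂ (Total G ω j) : ℂ) = Module.finrank ℂ
        (Representation.coindV (sumPerm e) (productRep G₁ G₂ ω₁ ω₂ j)) := by
      refine mul_left_cancel₀ h2 ?_
      rw [h1, finrank_total]
      simp only [Finset.mul_sum]
      refine Finset.sum_congr rfl fun F _ => ?_
      ring
    exact_mod_cast h3.symm
  exact ⟨kunneth_injective hsum j,
    (LinearMap.injective_iff_surjective_of_finrank_eq_finrank
      (V := Representation.coindV (sumPerm e) (productRep G₁ G₂ ω₁ ω₂ j))
      (V₂ := Total G ω j) hdim).mp (kunneth_injective hsum j)⟩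

end Kunneth

/-! ### Characters of the homology of a disjoint union -/

section Kunneth

open TensorProduct

variable {α₁ β₁ α₂ β₂ α β : Type*} {G₁ : Graph α₁ β₁} {G₂ : Graph α₂ β₂} {G : Graph α β}
  [Fintype V(G₁)] [Fintype V(G₂)] [Fintype V(G)] {a b c : ℕ} {ω₁ : Fin a ≃ E(G₁)}
  {ω₂ : Fin b ≃ E(G₂)} {ω : Fin c ≃ E(G)} {e : V(G₁) ⊕ V(G₂) ≃ V(G)}
  {ε : Fin a ⊕ Fin b ≃ Fin c}

theorem productRep_mul_piEnd (j : ℕ) (k : Equiv.Perm V(G₁) × Equiv.Perm V(G₂))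
    {f : ∀ p : Bidegree j, Module.End ℂ (Total G₁ ω₁ p.1.1 ⊗[ℂ] Total G₂ ω₂ p.1.2)}
    (h : ∀ p, TensorProduct.map (totalRep G₁ ω₁ p.1.1 k.1) (totalRep G₂ ω₂ p.1.2 k.2) * f p =
      f p * TensorProduct.map (totalRep G₁ ω₁ p.1.1 k.1) (totalRep G₂ ω₂ p.1.2 k.2)) :
    productRep G₁ G₂ ω₁ ω₂ j k * piEnd f = piEnd f * productRep G₁ G₂ ω₁ ω₂ j k :=
  (map_mul piEnd _ f).symm.trans ((congrArg piEnd (funext h)).trans (map_mul piEnd f _))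

theorem commute_map {M N : Type*} [AddCommGroup M] [Module ℂ M] [AddCommGroup N] [Module ℂ N]
    {f f' : Module.End ℂ M} {g g' : Module.End ℂ N} (hf : f * f' = f' * f) (hg : g * g' = g' * g) :
    TensorProduct.map f g * TensorProduct.map f' g' =
      TensorProduct.map f' g' * TensorProduct.map f g := by
  rw [← TensorProduct.map_mul, ← TensorProduct.map_mul, hf, hg]

theorem productRep_mul_productDiff (j : ℕ) (k : Equiv.Perm V(G₁) × Equiv.Perm V(G₂)) :
    productRep G₁ G₂ ω₁ ω₂ j k * productDiff G₁ G₂ ω₁ ω₂ j =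
      productDiff G₁ G₂ ω₁ ω₂ j * productRep G₁ G₂ ω₁ ω₂ j k := by
  refine productRep_mul_piEnd j k fun p => ?_
  rw [mul_add, add_mul, commute_map (totalRep_mul_totalDiff G₁ ω₁ p.1.1 k.1)
    (totalRep_mul_totalGrading G₂ ω₂ p.1.2 k.2 _), commute_map (mul_one _)
    (totalRep_mul_totalDiff G₂ ω₂ p.1.2 k.2)]

theorem productRep_mul_productGrading (j : ℕ) (w : ℕ → ℂ)
    (k : Equiv.Perm V(G₁) × Equiv.Perm V(G₂)) :
    productRep G₁ G₂ ω₁ ω₂ j k * productGrading G₁ G₂ ω₁ ω₂ j w =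
      productGrading G₁ G₂ ω₁ ω₂ j w * productRep G₁ G₂ ω₁ ω₂ j k := by
  refine productRep_mul_piEnd j k fun p => ?_
  rw [tensorGrading, Finset.mul_sum, Finset.sum_mul]
  refine Finset.sum_congr rfl fun i _ => ?_
  exact commute_map (totalRep_mul_totalGrading G₁ ω₁ p.1.1 k.1 _)
    (totalRep_mul_totalGrading G₂ ω₂ p.1.2 k.2 _)

theorem product_isContraction (j : ℕ) {h₁ π₁ : ∀ i, Module.End ℂ (Total G₁ ω₁ i)}
    {h₂ π₂ : ∀ i, Module.End ℂ (Total G₂ ω₂ i)}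
    (H₁ : ∀ i, IsContraction (totalDiff G₁ ω₁ i) (totalGrading G₁ ω₁ i) (h₁ i) (π₁ i))
    (H₂ : ∀ i, IsContraction (totalDiff G₂ ω₂ i) (totalGrading G₂ ω₂ i) (h₂ i) (π₂ i)) :
    IsContraction (productDiff G₁ G₂ ω₁ ω₂ j) (productGrading G₁ G₂ ω₁ ω₂ j)
      (piEnd fun p => TensorProduct.map (h₁ p.1.1)
        (totalGrading G₂ ω₂ p.1.2 fun i => (-1) ^ (b + i)) +
          TensorProduct.map (π₁ p.1.1) (h₂ p.1.2))
      (piEnd fun p => TensorProduct.map (π₁ p.1.1) (π₂ p.1.2)) :=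
  IsContraction.pi fun p => (H₁ p.1.1).tensor (H₂ p.1.2) (b + 1)
    (sum_totalGrading G₂ ω₂ p.1.2) (totalDiff_mul_totalGrading G₂ ω₂ p.1.2)
    (fun i => by rw [← add_assoc, pow_succ]; ring)
    (fun i => by rw [← mul_pow]; simp)

theorem trace_eq_of_intertwines {M N : Type*} [AddCommGroup M] [Module ℂ M] [AddCommGroup N]
    [Module ℂ N] (Ψ : M ≃ₗ[ℂ] N) {f : Module.End ℂ M} {g : Module.End ℂ N}
    (h : ∀ x, g (Ψ x) = Ψ (f x)) : LinearMap.trace ℂ N g = LinearMap.trace ℂ M f := by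
  rw [← LinearMap.trace_conj' f Ψ]
  congr 1
  refine LinearMap.ext fun y => ?_
  rw [LinearEquiv.conj_apply_apply, ← h, Ψ.apply_symm_apply]

/-- The trace of a product operator on the part of degree `i` of a tensor product. -/
theorem trace_map_mul_tensorGrading {M N : Type*} [AddCommGroup M] [Module ℂ M] [AddCommGroup N]
    [Module ℂ N] [FiniteDimensional ℂ M] [FiniteDimensional ℂ N]
    (e : (ℕ → ℂ) →ₐ[ℂ] Module.End ℂ M) (e' : (ℕ → ℂ) →ₐ[ℂ] Module.End ℂ N) (K i : ℕ)
    (hK : ∑ i ∈ Finset.range K, e' (Pi.single i 1) = 1) (f f' : Module.End ℂ M)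
    (g g' : Module.End ℂ N) :
    LinearMap.trace ℂ (M ⊗[ℂ] N) (TensorProduct.map f g * tensorGrading e e' K (Pi.single i 1) *
      TensorProduct.map f' g') =
      ∑ q ∈ Finset.HasAntidiagonal.antidiagonal i,
        LinearMap.trace ℂ M (f * e (Pi.single q.1 1) * f') *
          LinearMap.trace ℂ N (g * e' (Pi.single q.2 1) * g') := by
  have hlast : ∀ k, K ≤ k → e' (Pi.single k 1) = 0 := fun k hk => by
    rw [← one_mul (e' _), ← hK, Finset.sum_mul]
    refine Finset.sum_eq_zero fun l hl => ?_
    rw [← map_mul, ← map_zero e']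
    congr 1
    have hne : l ≠ k := ((Finset.mem_range.mp hl).trans_le hk).ne
    ext x
    by_cases hx : x = l <;> simp_all
  let t : ℕ → ℂ := fun k => LinearMap.trace ℂ M (f * e (fun l => (Pi.single i 1 : ℕ → ℂ) (l + k)) *
    f') * LinearMap.trace ℂ N (g * e' (Pi.single k 1) * g')
  have h1 : LinearMap.trace ℂ (M ⊗[ℂ] N) (TensorProduct.map f g *
      tensorGrading e e' K (Pi.single i 1) * TensorProduct.map f' g') =
      ∑ k ∈ Finset.range K, t k := by
    rw [tensorGrading, Finset.mul_sum, Finset.sum_mul, map_sum]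
    refine Finset.sum_congr rfl fun k _ => ?_
    rw [← TensorProduct.map_mul, ← TensorProduct.map_mul, LinearMap.trace_tensorProduct']
  have h2 : ∀ k, K ≤ k → t k = 0 := fun k hk => by
    simp only [t]
    rw [hlast k hk, mul_zero, zero_mul, map_zero, mul_zero]
  have h3 : ∀ k, i < k → t k = 0 := fun k hk => by
    simp only [t]
    have : (fun l => (Pi.single i 1 : ℕ → ℂ) (l + k)) = 0 := by
      ext l
      exact Pi.single_eq_of_ne (by omega) _
    rw [this, map_zero, mul_zero, zero_mul, map_zero, zero_mul]
  have h4 : ∀ k ≤ i, (fun l => (Pi.single i 1 : ℕ → ℂ) (l + k)) = Pi.single (i - k) 1 :=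
    fun k hk => by
      ext l
      by_cases hl : l = i - k
      · rw [hl, Pi.single_eq_same, Nat.sub_add_cancel hk, Pi.single_eq_same]
      · rw [Pi.single_eq_of_ne hl, Pi.single_eq_of_ne (by omega)]
  -- `K` and `i` are unrelated; the terms vanish for `k ≥ K` and for `k > i`, so both sums extend to
  -- a common range.
  have h5 : ∑ k ∈ Finset.range K, t k = ∑ k ∈ Finset.range (i + 1), t k := by
    rw [Finset.sum_subset (Finset.range_mono (le_max_left K (i + 1))) fun k _ hk =>
        h2 k (by simpa using hk),
      Finset.sum_subset (Finset.range_mono (le_max_right K (i + 1))) fun k _ hk =>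
        h3 k (by rw [Finset.mem_range, not_lt] at hk; exact hk)]
  rw [h1, h5, ← Finset.Nat.sum_antidiagonal_swap, Finset.Nat.sum_antidiagonal_eq_sum_range_succ_mk]
  refine Finset.sum_congr rfl fun k hk => ?_
  simp only [t, Prod.fst_swap, Prod.snd_swap]
  rw [h4 k (Finset.mem_range_succ_iff.mp hk)]

/-- The characters of the homology of two graphs, as the character of an operator on the product of
their total complexes. -/
theorem trace_product_eq_sum (j i : ℕ) {h₁ π₁ : ∀ i, Module.End ℂ (Total G₁ ω₁ i)}
    {h₂ π₂ : ∀ i, Module.End ℂ (Total G₂ ω₂ i)}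
    (H₁ : ∀ i, IsContraction (totalDiff G₁ ω₁ i) (totalGrading G₁ ω₁ i) (h₁ i) (π₁ i))
    (H₂ : ∀ i, IsContraction (totalDiff G₂ ω₂ i) (totalGrading G₂ ω₂ i) (h₂ i) (π₂ i))
    (k : Equiv.Perm V(G₁) × Equiv.Perm V(G₂)) :
    LinearMap.trace ℂ (ProductTotal G₁ G₂ ω₁ ω₂ j)
      ((piEnd fun p => TensorProduct.map (π₁ p.1.1) (π₂ p.1.2)) *
        productGrading G₁ G₂ ω₁ ω₂ j (Pi.single i 1) * productRep G₁ G₂ ω₁ ω₂ j k) =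
      ∑ p : Bidegree j, ∑ q ∈ Finset.HasAntidiagonal.antidiagonal i,
        (homologyRep G₁ ω₁ q.1 p.1.1).character k.1 *
          (homologyRep G₂ ω₂ q.2 p.1.2).character k.2 := by
  refine (trace_piEnd fun p : Bidegree j => TensorProduct.map (π₁ p.1.1) (π₂ p.1.2) *
        tensorGrading (totalGrading G₁ ω₁ p.1.1) (totalGrading G₂ ω₂ p.1.2) (b + 1)
          (Pi.single i 1) *
        TensorProduct.map (totalRep G₁ ω₁ p.1.1 k.1) (totalRep G₂ ω₂ p.1.2 k.2)).trans ?_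
  refine Finset.sum_congr rfl fun p _ => ?_
  rw [trace_map_mul_tensorGrading _ _ _ _ (sum_totalGrading G₂ ω₂ p.1.2)]
  refine Finset.sum_congr rfl fun q _ => ?_
  rw [character_homologyRep G₁ ω₁ _ (H₁ _), character_homologyRep G₂ ω₂ _ (H₂ _),
    LinearMap.trace_mul_comm, LinearMap.trace_mul_comm ℂ _ (totalRep G₂ ω₂ p.1.2 k.2)]

/-- The total complex of a disjoint union is coinduced from the product of the total complexes of
its parts. -/
def kunnethEquiv (hsum : ∀ F, IsSum e (components G ω F)
    (components G₁ ω₁ (leftState ε F)) (components G₂ ω₂ (rightState ε F))) (j : ℕ) :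
    Representation.coindV (sumPerm e) (productRep G₁ G₂ ω₁ ω₂ j) ≃ₗ[ℂ]
    Total G ω j :=
  LinearEquiv.ofBijective _ (kunneth_bijective hsum j)

theorem kunnethEquiv_coind (hsum : ∀ F, IsSum e (components G ω F)
    (components G₁ ω₁ (leftState ε F)) (components G₂ ω₂ (rightState ε F))) (j : ℕ)
    (σ : Equiv.Perm V(G))
    (φ : Representation.coindV (sumPerm e) (productRep G₁ G₂ ω₁ ω₂ j)) :
    kunnethEquiv hsum j (Representation.coind (sumPerm e) (productRep G₁ G₂ ω₁ ω₂ j) σ φ) =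
      totalRep G ω j σ (kunnethEquiv hsum j φ) := rfl

theorem kunnethEquiv_productDiff (hsum : ∀ F, IsSum e (components G ω F)
    (components G₁ ω₁ (leftState ε F)) (components G₂ ω₂ (rightState ε F))) (j : ℕ)
    (φ : Representation.coindV (sumPerm e) (productRep G₁ G₂ ω₁ ω₂ j)) :
    kunnethEquiv hsum j (coindEnd (sumPerm e) (productRep G₁ G₂ ω₁ ω₂ j) _
      (productRep_mul_productDiff j) φ) = totalDiff G ω j (kunnethEquiv hsum j φ) :=
  funext fun F => BlockModule.ext_eval fun σ => (eval_totalDiff_kunneth hsum j φ F σ).symm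

theorem kunnethEquiv_productGrading (hsum : ∀ F, IsSum e (components G ω F)
    (components G₁ ω₁ (leftState ε F)) (components G₂ ω₂ (rightState ε F))) (j : ℕ) (w : ℕ → ℂ)
    (φ : Representation.coindV (sumPerm e) (productRep G₁ G₂ ω₁ ω₂ j)) :
    kunnethEquiv hsum j (coindEnd (sumPerm e) (productRep G₁ G₂ ω₁ ω₂ j) _
      (productRep_mul_productGrading j w) φ) = totalGrading G ω j w (kunnethEquiv hsum j φ) :=
  funext fun F => BlockModule.ext_eval fun σ => by
    change stateSign ε F • glue hsum j F (productGrading G₁ G₂ ω₁ ω₂ j w (φ.1 σ)) =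
      w F.card • stateSign ε F • glue hsum j F (φ.1 σ)
    rw [glue_productGrading, smul_comm]

/-- Coinducing the contraction of the product complex and conjugating by `kunnethEquiv` yields a
contraction of the total complex, to which `character_homologyRep` applies; traces are invariant
under conjugation. -/
theorem character_homologyRep_eq_trace_coind (hsum : ∀ F, IsSum e (components G ω F)
    (components G₁ ω₁ (leftState ε F)) (components G₂ ω₂ (rightState ε F))) (j : ℕ)
    {h π : Module.End ℂ (ProductTotal G₁ G₂ ω₁ ω₂ j)}
    (H : IsContraction (productDiff G₁ G₂ ω₁ ω₂ j) (productGrading G₁ G₂ ω₁ ω₂ j) h π)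
    (hh : ∀ k, productRep G₁ G₂ ω₁ ω₂ j k * h = h * productRep G₁ G₂ ω₁ ω₂ j k)
    (hπ : ∀ k, productRep G₁ G₂ ω₁ ω₂ j k * π = π * productRep G₁ G₂ ω₁ ω₂ j k) (i : ℕ)
    (hQ : ∀ k, productRep G₁ G₂ ω₁ ω₂ j k * (π * productGrading G₁ G₂ ω₁ ω₂ j (Pi.single i 1)) =
      π * productGrading G₁ G₂ ω₁ ω₂ j (Pi.single i 1) * productRep G₁ G₂ ω₁ ω₂ j k)
    (σ : Equiv.Perm V(G)) :
    (homologyRep G ω i j).character σ = LinearMap.trace ℂ _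
      (Representation.coind (sumPerm e) (productRep G₁ G₂ ω₁ ω₂ j) σ *
        coindEnd (sumPerm e) (productRep G₁ G₂ ω₁ ω₂ j) _ hQ) := by
  have H' := (H.coind (sumPerm e) (productRep G₁ G₂ ω₁ ω₂ j) (productRep_mul_productDiff j)
    (productRep_mul_productGrading j) hh hπ).conj (kunnethEquiv hsum j)
    (kunnethEquiv_productDiff hsum j) (kunnethEquiv_productGrading hsum j)
  rw [character_homologyRep G ω j H']
  refine trace_eq_of_intertwines
    (M := Representation.coindV (sumPerm e) (productRep G₁ G₂ ω₁ ω₂ j)) (N := Total G ω j)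
    (kunnethEquiv hsum j) fun φ => ?_
  rw [Module.End.mul_apply, Module.End.mul_apply, ← kunnethEquiv_productGrading,
    LinearEquiv.conj_apply_apply,
    LinearEquiv.symm_apply_apply, ← kunnethEquiv_coind]
  rfl

end Kunneth

/-- The average over a product of two finite types of sums of products. -/
theorem average_sum_mul {X Y ι κ R : Type*} [Fintype X] [Fintype Y] [Fintype ι] [Ring R]
    [Algebra ℂ R] (s : Finset κ) (f : ι → κ → X → ℂ) (g : ι → κ → Y → ℂ) (p : X → R) (q : Y → R) :
    (Fintype.card (X × Y) : ℂ)⁻¹ • ∑ k : X × Y, (∑ i, ∑ l ∈ s, f i l k.1 * g i l k.2) •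
        (p k.1 * q k.2) =
      ∑ i, ∑ l ∈ s, ((Fintype.card X : ℂ)⁻¹ • ∑ x, f i l x • p x) *
        ((Fintype.card Y : ℂ)⁻¹ • ∑ y, g i l y • q y) := by
  simp only [smul_mul_smul_comm, Finset.sum_mul_sum, ← Finset.smul_sum, Finset.sum_smul,
    Fintype.card_prod, Nat.cast_mul, mul_inv]
  congr 1
  rw [Finset.sum_comm]
  refine Finset.sum_congr rfl fun i _ => ?_
  rw [Finset.sum_comm]
  exact Finset.sum_congr rfl fun l _ => Fintype.sum_prod_type _

/-! ### Frobenius characteristics of the homology of a disjoint union -/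

section Kunneth

open TensorProduct

variable {α₁ β₁ α₂ β₂ α β : Type*} {G₁ : Graph α₁ β₁} {G₂ : Graph α₂ β₂} {G : Graph α β}
  [Fintype V(G₁)] [Fintype V(G₂)] [Fintype V(G)] {a b c : ℕ} {ω₁ : Fin a ≃ E(G₁)}
  {ω₂ : Fin b ≃ E(G₂)} {ω : Fin c ≃ E(G)} {e : V(G₁) ⊕ V(G₂) ≃ V(G)}
  {ε : Fin a ⊕ Fin b ≃ Fin c}

/-- Frobenius' formula is applied with the class function `cyclePowerSum`, which is multiplicative
on block permutations. -/
theorem frobeniusChar_homologyRep_eq_trace [DecidableEq V(G₁)] [DecidableEq V(G₂)]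
    [DecidableEq V(G)] (hsum : ∀ F, IsSum e (components G ω F)
    (components G₁ ω₁ (leftState ε F)) (components G₂ ω₂ (rightState ε F))) (j : ℕ)
    {h π : Module.End ℂ (ProductTotal G₁ G₂ ω₁ ω₂ j)}
    (H : IsContraction (productDiff G₁ G₂ ω₁ ω₂ j) (productGrading G₁ G₂ ω₁ ω₂ j) h π)
    (hh : ∀ k, productRep G₁ G₂ ω₁ ω₂ j k * h = h * productRep G₁ G₂ ω₁ ω₂ j k)
    (hπ : ∀ k, productRep G₁ G₂ ω₁ ω₂ j k * π = π * productRep G₁ G₂ ω₁ ω₂ j k) (i : ℕ) :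
    frobeniusChar (homologyRep G ω i j) =
      (Fintype.card (Equiv.Perm V(G₁) × Equiv.Perm V(G₂)) : ℂ)⁻¹ •
        ∑ k : Equiv.Perm V(G₁) × Equiv.Perm V(G₂),
          LinearMap.trace ℂ _ (π * productGrading G₁ G₂ ω₁ ω₂ j (Pi.single i 1) *
            productRep G₁ G₂ ω₁ ω₂ j k) • (cyclePowerSum k.1 * cyclePowerSum k.2) := by
  have hQ : ∀ k, productRep G₁ G₂ ω₁ ω₂ j k *
      (π * productGrading G₁ G₂ ω₁ ω₂ j (Pi.single i 1)) =
      π * productGrading G₁ G₂ ω₁ ω₂ j (Pi.single i 1) * productRep G₁ G₂ ω₁ ω₂ j k := fun k => by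
    rw [← mul_assoc, hπ, mul_assoc, productRep_mul_productGrading, mul_assoc]
  refine (frobeniusChar_eq _).trans ?_
  refine (congrArg _ (Finset.sum_congr rfl fun σ _ => congrArg (· • cyclePowerSum σ)
    (character_homologyRep_eq_trace_coind hsum j H hh hπ i hQ σ))).trans ?_
  refine (sum_trace_coind_smul (sumPerm e) _ cyclePowerSum
    (fun g x => cyclePowerSum_conj g x) _ hQ).trans ?_
  exact congrArg _ (Finset.sum_congr rfl fun k _ => congrArg _ (cyclePowerSum_sumPerm e k))

theorem frobeniusChar_homologyRep [DecidableEq V(G₁)] [DecidableEq V(G₂)] [DecidableEq V(G)]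
    (hsum : ∀ F, IsSum e (components G ω F)
    (components G₁ ω₁ (leftState ε F)) (components G₂ ω₂ (rightState ε F))) (j i : ℕ) :
    frobeniusChar (homologyRep G ω i j) =
      ∑ p : Bidegree j, ∑ q ∈ Finset.HasAntidiagonal.antidiagonal i,
        frobeniusChar (homologyRep G₁ ω₁ q.1 p.1.1) *
          frobeniusChar (homologyRep G₂ ω₂ q.2 p.1.2) := by
  choose h₁ π₁ H₁ hρ₁ πρ₁ using fun i => exists_total_isContraction G₁ ω₁ i
  choose h₂ π₂ H₂ hρ₂ πρ₂ using fun i => exists_total_isContraction G₂ ω₂ i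
  refine (frobeniusChar_homologyRep_eq_trace hsum j (product_isContraction j H₁ H₂)
    (fun k => productRep_mul_piEnd j k fun p => ?_)
    (fun k => productRep_mul_piEnd j k fun p => commute_map (πρ₁ _ _) (πρ₂ _ _)) i).trans ?_
  · exact (mul_add _ _ _).trans ((congrArg₂ (· + ·)
      (commute_map (hρ₁ _ _) (totalRep_mul_totalGrading G₂ ω₂ p.1.2 k.2 _))
      (commute_map (πρ₁ _ _) (hρ₂ _ _))).trans (add_mul _ _ _).symm)
  · have h1 := average_sum_mul (R := SymFun) (Finset.HasAntidiagonal.antidiagonal i)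
      (fun (p : Bidegree j) q => (homologyRep G₁ ω₁ q.1 p.1.1).character)
      (fun (p : Bidegree j) q => (homologyRep G₂ ω₂ q.2 p.1.2).character) cyclePowerSum
      cyclePowerSum
    simp only [← frobeniusChar_eq] at h1
    refine Eq.trans ?_ h1
    refine congrArg _ (Finset.sum_congr rfl fun k _ => ?_)
    rw [trace_product_eq_sum j i H₁ H₂ k]

end Kunneth

/-! ### Disjoint unions of graphs -/

/-- The elements of a disjoint union of sets. -/
def sumImageEquiv {X Y : Type*} (s : Set X) (t : Set Y) :
    s ⊕ t ≃ ↥(Sum.inl '' s ∪ Sum.inr '' t : Set (X ⊕ Y)) :=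
  Equiv.ofBijective
    (Sum.elim (fun x => ⟨Sum.inl x.1, Or.inl ⟨x.1, x.2, rfl⟩⟩)
      (fun y => ⟨Sum.inr y.1, Or.inr ⟨y.1, y.2, rfl⟩⟩)) (by
    constructor
    · rintro (⟨x, hx⟩ | ⟨y, hy⟩) (⟨x', hx'⟩ | ⟨y', hy'⟩) h <;>
        simpa using congrArg Subtype.val h
    · rintro ⟨_, ⟨x, hx, rfl⟩ | ⟨y, hy, rfl⟩⟩
      · exact ⟨Sum.inl ⟨x, hx⟩, rfl⟩
      · exact ⟨Sum.inr ⟨y, hy⟩, rfl⟩)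

section DisjointUnion

variable {α β α' β' : Type*} (A : Graph α β) (B : Graph α' β') {a b c : ℕ} (ωA : Fin a ≃ E(A))
  (ωB : Fin b ≃ E(B)) (ω : Fin c ≃ E(disjointUnion A B))

/-- The vertices of a disjoint union. -/
def unionVertexEquiv : V(A) ⊕ V(B) ≃ V(disjointUnion A B) := sumImageEquiv V(A) V(B)

/-- The enumerated edges of a disjoint union. -/
def unionEdgeEquiv : Fin a ⊕ Fin b ≃ Fin c :=
  ((Equiv.sumCongr ωA ωB).trans (sumImageEquiv E(A) E(B))).trans ω.symm

theorem edge_unionEdgeEquiv_inl (k : Fin a) :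
    (ω (unionEdgeEquiv A B ωA ωB ω (Sum.inl k))).1 = Sum.inl (ωA k).1 :=
  congrArg Subtype.val (ω.apply_symm_apply _)

theorem edge_unionEdgeEquiv_inr (k : Fin b) :
    (ω (unionEdgeEquiv A B ωA ωB ω (Sum.inr k))).1 = Sum.inr (ωB k).1 :=
  congrArg Subtype.val (ω.apply_symm_apply _)

theorem isLink_edge_inl {k : Fin a} {x y : V(A) ⊕ V(B)} :
    (disjointUnion A B).IsLink (ω (unionEdgeEquiv A B ωA ωB ω (Sum.inl k)))
      (unionVertexEquiv A B x) (unionVertexEquiv A B y) ↔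
      ∃ x' y', x = Sum.inl x' ∧ y = Sum.inl y' ∧ A.IsLink (ωA k) x' y' := by
  rw [edge_unionEdgeEquiv_inl]
  constructor
  · obtain x | x := x <;> obtain y | y := y <;> intro h
    · exact ⟨x, y, rfl, rfl, h⟩
    all_goals exact h.elim
  · rintro ⟨x', y', rfl, rfl, h⟩
    exact h

theorem isLink_edge_inr {k : Fin b} {x y : V(A) ⊕ V(B)} :
    (disjointUnion A B).IsLink (ω (unionEdgeEquiv A B ωA ωB ω (Sum.inr k)))
      (unionVertexEquiv A B x) (unionVertexEquiv A B y) ↔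
      ∃ x' y', x = Sum.inr x' ∧ y = Sum.inr y' ∧ B.IsLink (ωB k) x' y' := by
  rw [edge_unionEdgeEquiv_inr]
  constructor
  · obtain x | x := x <;> obtain y | y := y <;> intro h
    rotate_right
    · exact ⟨x, y, rfl, rfl, h⟩
    all_goals exact (h : False).elim
  · rintro ⟨x', y', rfl, rfl, h⟩
    exact h

variable (F : Finset (Fin c))

/-- No edge joins the two parts, so the generating links lie in `Sum.LiftRel` of the two component
relations, which is itself an equivalence relation. -/
theorem components_disjointUnion_le {x y : V(disjointUnion A B)}
    (h : components (disjointUnion A B) ω F x y) :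
    Sum.LiftRel (components A ωA (leftState (unionEdgeEquiv A B ωA ωB ω) F))
      (components B ωB (rightState (unionEdgeEquiv A B ωA ωB ω) F))
      ((unionVertexEquiv A B).symm x) ((unionVertexEquiv A B).symm y) := by
  induction h with
  | rel x y h =>
    obtain ⟨k, hk, hl⟩ := h
    obtain ⟨x, rfl⟩ := (unionVertexEquiv A B).surjective x
    obtain ⟨y, rfl⟩ := (unionVertexEquiv A B).surjective y
    obtain ⟨k, rfl⟩ := (unionEdgeEquiv A B ωA ωB ω).surjective k
    rw [Equiv.symm_apply_apply, Equiv.symm_apply_apply]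
    obtain k | k := k
    · obtain ⟨x', y', rfl, rfl, hl'⟩ := (isLink_edge_inl A B ωA ωB ω).mp hl
      exact Sum.LiftRel.inl (.rel _ _ ⟨k, mem_leftState.mpr hk, hl'⟩)
    · obtain ⟨x', y', rfl, rfl, hl'⟩ := (isLink_edge_inr A B ωA ωB ω).mp hl
      exact Sum.LiftRel.inr (.rel _ _ ⟨k, mem_rightState.mpr hk, hl'⟩)
  | refl x =>
    obtain x | x := (unionVertexEquiv A B).symm x
    · exact Sum.LiftRel.inl (Setoid.refl' _ _)
    · exact Sum.LiftRel.inr (Setoid.refl' _ _)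
  | symm x y _ ih =>
    generalize (unionVertexEquiv A B).symm x = x' at *
    generalize (unionVertexEquiv A B).symm y = y' at *
    cases ih with
    | inl h => exact Sum.LiftRel.inl (Setoid.symm' _ h)
    | inr h => exact Sum.LiftRel.inr (Setoid.symm' _ h)
  | trans x y z _ _ ih₁ ih₂ =>
    generalize (unionVertexEquiv A B).symm x = x' at *
    generalize (unionVertexEquiv A B).symm y = y' at *
    generalize (unionVertexEquiv A B).symm z = z' at *
    cases ih₁ with
    | inl h =>
      cases ih₂ with
      | inl h' => exact Sum.LiftRel.inl (Setoid.trans' _ h h')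
    | inr h =>
      cases ih₂ with
      | inr h' => exact Sum.LiftRel.inr (Setoid.trans' _ h h')

theorem components_inl_of_components {x y : V(A)}
    (h : components A ωA (leftState (unionEdgeEquiv A B ωA ωB ω) F) x y) :
    components (disjointUnion A B) ω F (unionVertexEquiv A B (Sum.inl x))
      (unionVertexEquiv A B (Sum.inl y)) := by
  induction h with
  | rel x y h =>
    obtain ⟨k, hk, h⟩ := h
    exact .rel _ _ ⟨_, mem_leftState.mp hk, (isLink_edge_inl A B ωA ωB ω).mpr ⟨x, y, rfl, rfl, h⟩⟩
  | refl x => exact .refl _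
  | symm x y _ ih => exact .symm _ _ ih
  | trans x y z _ _ ih₁ ih₂ => exact .trans _ _ _ ih₁ ih₂

theorem components_inr_of_components {x y : V(B)}
    (h : components B ωB (rightState (unionEdgeEquiv A B ωA ωB ω) F) x y) :
    components (disjointUnion A B) ω F (unionVertexEquiv A B (Sum.inr x))
      (unionVertexEquiv A B (Sum.inr y)) := by
  induction h with
  | rel x y h =>
    obtain ⟨k, hk, h⟩ := h
    exact .rel _ _ ⟨_, mem_rightState.mp hk, (isLink_edge_inr A B ωA ωB ω).mpr ⟨x, y, rfl, rfl, h⟩⟩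
  | refl x => exact .refl _
  | symm x y _ ih => exact .symm _ _ ih
  | trans x y z _ _ ih₁ ih₂ => exact .trans _ _ _ ih₁ ih₂

theorem isSum_components_disjointUnion :
    IsSum (unionVertexEquiv A B) (components (disjointUnion A B) ω F)
      (components A ωA (leftState (unionEdgeEquiv A B ωA ωB ω) F))
      (components B ωB (rightState (unionEdgeEquiv A B ωA ωB ω) F)) where
  inl_iff x y := ⟨fun h => by
    simpa using components_disjointUnion_le A B ωA ωB ω F h,
    components_inl_of_components A B ωA ωB ω F⟩
  inr_iff x y := ⟨fun h => by
    simpa using components_disjointUnion_le A B ωA ωB ω F h,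
    components_inr_of_components A B ωA ωB ω F⟩
  not_rel x y h := by
    simpa using components_disjointUnion_le A B ωA ωB ω F h

theorem frobeniusChar_disjointUnion [Fintype V(A)] [Fintype V(B)] [DecidableEq V(A)]
    [DecidableEq V(B)] [DecidableEq V(disjointUnion A B)] (i j : ℕ) :
    frobeniusChar (homologyRep (disjointUnion A B) ω i j) =
      ∑ p ∈ Finset.HasAntidiagonal.antidiagonal j,
        ∑ q ∈ Finset.HasAntidiagonal.antidiagonal i,
        frobeniusChar (homologyRep A ωA q.1 p.1) * frobeniusChar (homologyRep B ωB q.2 p.2) := by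
  rw [frobeniusChar_homologyRep (isSum_components_disjointUnion A B ωA ωB ω) j i]
  exact Finset.sum_coe_sort (Finset.HasAntidiagonal.antidiagonal j) fun p =>
    ∑ q ∈ Finset.HasAntidiagonal.antidiagonal i,
      frobeniusChar (homologyRep A ωA q.1 p.1) * frobeniusChar (homologyRep B ωB q.2 p.2)

end DisjointUnion

/-- The product of power series in two variables, in terms of coefficients. -/
theorem coeff_mul_fin_two {R : Type*} [Semiring R] (f g : MvPowerSeries (Fin 2) R)
    (d : Fin 2 →₀ ℕ) : MvPowerSeries.coeff d (f * g) =
      ∑ p ∈ Finset.HasAntidiagonal.antidiagonal (d 0),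
        ∑ q ∈ Finset.HasAntidiagonal.antidiagonal (d 1),
          MvPowerSeries.coeff (Finsupp.equivFunOnFinite.symm ![p.1, q.1]) f *
            MvPowerSeries.coeff (Finsupp.equivFunOnFinite.symm ![p.2, q.2]) g := by
  classical
  have hd : ∀ d : Fin 2 →₀ ℕ, Finsupp.equivFunOnFinite.symm ![d 0, d 1] = d := fun d => by
    ext k
    fin_cases k <;> rfl
  rw [MvPowerSeries.coeff_mul, ← Finset.sum_product']
  refine Finset.sum_bij' (fun x _ => ((x.1 0, x.2 0), (x.1 1, x.2 1)))
    (fun y _ => (Finsupp.equivFunOnFinite.symm ![y.1.1, y.2.1],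
      Finsupp.equivFunOnFinite.symm ![y.1.2, y.2.2])) ?_ ?_ ?_ ?_ ?_
  · intro x hx
    rw [Finset.HasAntidiagonal.mem_antidiagonal] at hx
    rw [Finset.mem_product, Finset.HasAntidiagonal.mem_antidiagonal,
      Finset.HasAntidiagonal.mem_antidiagonal, ← hx]
    exact ⟨rfl, rfl⟩
  · intro y hy
    rw [Finset.mem_product, Finset.HasAntidiagonal.mem_antidiagonal,
      Finset.HasAntidiagonal.mem_antidiagonal] at hy
    rw [Finset.HasAntidiagonal.mem_antidiagonal]
    ext k
    fin_cases k
    · exact hy.1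
    · exact hy.2
  · intro x _
    exact Prod.ext (hd x.1) (hd x.2)
  · intro y _
    rfl
  · intro x _
    exact congrArg₂ (· * ·) (congrArg (MvPowerSeries.coeff · f) (hd x.1).symm)
      (congrArg (MvPowerSeries.coeff · g) (hd x.2).symm)

section Series

variable {α β : Type*} (G : Graph α β) [Fintype V(G)] {m : ℕ} (ω : Fin m ≃ E(G))

/-- The series is defined with classical decidability; this restates its coefficients for an
arbitrary instance. -/
theorem coeff_frobeniusSeries [inst : DecidableEq V(G)] (d : Fin 2 →₀ ℕ) :
    MvPowerSeries.coeff d (frobeniusSeries G ω) =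
      (-1) ^ (d 1 + d 0) * frobeniusChar (homologyRep G ω (d 1) (d 0)) := by
  classical
  have h : MvPowerSeries.coeff d (frobeniusSeries G ω) =
      (-1) ^ (d 1 + d 0) * @frobeniusChar _ _ _ (Classical.decEq _) _ _
        (homologyRep G ω (d 1) (d 0)) := by
    rw [MvPowerSeries.coeff_apply, frobeniusSeries]
    congr!
  rw [h]
  congr!

theorem coeff_frobeniusSeries_pair [DecidableEq V(G)] (j i : ℕ) :
    MvPowerSeries.coeff (Finsupp.equivFunOnFinite.symm ![j, i]) (frobeniusSeries G ω) =
      (-1) ^ (i + j) * frobeniusChar (homologyRep G ω i j) :=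
  coeff_frobeniusSeries G ω _

end Series

end ChromaticHomology

end

theorem mainTheorem6 {α β α' β' : Type*} (A : Graph α β) (B : Graph α' β')
    [Fintype V(A)] [Fintype V(B)] {a b c : ℕ} (ωA : Fin a ≃ E(A)) (ωB : Fin b ≃ E(B))
    (ω : Fin c ≃ E(ChromaticHomology.disjointUnion A B)) :
    ChromaticHomology.frobeniusSeries (ChromaticHomology.disjointUnion A B) ω =
      ChromaticHomology.frobeniusSeries A ωA * ChromaticHomology.frobeniusSeries B ωB := by
  classical
  refine MvPowerSeries.ext fun d => ?_
  rw [ChromaticHomology.coeff_mul_fin_two, ChromaticHomology.coeff_frobeniusSeries,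
    ChromaticHomology.frobeniusChar_disjointUnion A B ωA ωB ω, Finset.mul_sum]
  refine Finset.sum_congr rfl fun p hp => ?_
  rw [Finset.mul_sum]
  refine Finset.sum_congr rfl fun q hq => ?_
  -- The two signs combine because both the homological and the exterior degrees add up to those of
  -- the coefficient.
  rw [ChromaticHomology.coeff_frobeniusSeries_pair, ChromaticHomology.coeff_frobeniusSeries_pair,
    mul_mul_mul_comm, ← pow_add, add_add_add_comm,
    Finset.HasAntidiagonal.mem_antidiagonal.mp hp, Finset.HasAntidiagonal.mem_antidiagonal.mp hq]
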